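/- Let $\Gamma$ be a finite connected graph with oriented edges. A morphism $f\colon\Gamma\to\Gamma$ maps vertices to vertices and each edge $e$ to an edge-path from $f(\mathsf o(e))$ to $f(\mathsf t(e))$. Let $f$ be a morphism that is a homotopy equivalence and fixes a vertex $*$, and let $H\subset\Gamma$ be a subgraph with $f(H)\subseteq H$. Put $\mathbb F=\pi_1(\Gamma,*)$, let $\widetilde\Gamma$ be the universal cover, $\widetilde H\subset\widetilde\Gamma$ the preimage of $H$, and $\tilde f$ the lift of $f$ fixing a chosen lift of $*$; $\mathbb F$ acts on $\widetilde\Gamma$ by deck transformations. Let $A_f$ be the map induced by $\tilde f$ on $C_1(\widetilde\Gamma;\mathbb Q)$, let $C_1(\widetilde\Gamma,\widetilde H;\mathbb Q)$ be the $\mathbb Q[\mathbb F]$-submodule of chains $x=\sum x_e e$ with $x_e=0$ for all $e\in\mathsf E(\widetilde H)$, let $\pi_H^\perp$ be the coordinate projection of $C_1(\widetilde\Gamma;\mathbb Q)$ onto it, and put $A=A_{f,H}=\pi_H^\perp\circ A_f|_{C_1(\widetilde\Gamma,\widetilde H;\mathbb Q)}$. Write $\langle x,x'\rangle=\sum_e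 x_ex'_e$, $\|x\|^2=\langle x,x\rangle$ and $\operatorname{supp}(x)=\{e: x_e\ne0\}$. A \emph{Nielsen 1-chain} is a chain $\rho=\pi_H^\perp([u,v])$, where $u\neq v$ are vertices of $\widetilde\Gamma$ fixed by $\tilde f$ and $[u,v]$ is the unique 1-chain with boundary $v-u$, that satisfies one of the following. (Non-geometric) There is an edge $e\in\mathsf E(\widetilde\Gamma)-\mathsf E(\widetilde H)$ with $\rho_e=\pm1$ and $\rho_{ge}=0$ for all $1\neq g\in\mathbb F$. (Geometric) For distinct $g_1,g_2\in\mathbb F$ the set $\operatorname{supp}(g_1\rho)\cap\operatorname{supp}(g_2\rho)$ has at most one element; for every edge $e\in\mathsf E(\widetilde\Gamma)-\mathsf E(\widetilde H)$ there is exactly one unordered pair of distinct elements $g_1,g_2\in\mathbb F$ with $\operatorname{supp}(g_1\rho)\cap\operatorname{supp}(g_2\rho)=\{e\}$; and there are non-commuting $g_1,g_2\in\mathbb F$ such that $\operatorname{supp}(\rho)\cap\operatorname{supp}(g_i\rho)\neq\emptyset$ for $i=1,2$. Suppose that $f$ satisfies the \emph{chain flare condition} relative to $H$ with $\mathbb Q[\mathbb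 F]$-submodules $V_{\rm h},V_{\rm qf}\subseteq C_1(\widetilde\Gamma,\widetilde H;\mathbb Q)$, that is: (1) $C_1(\widetilde\Gamma,\widetilde H;\mathbb Q)=V_{\rm h}+V_{\rm qf}$. (2) There are $\lambda_0>1$ and $0<\theta<1$ with $\lambda_0\|A(x)\|\le\max\{\|A^2(x)\|,\|x\|\}$ for all $x\in N_\theta(V_{\rm h})^\infty$. Here $N_\theta(V_{\rm h})$ is the set of all $x'\in C_1(\widetilde\Gamma,\widetilde H;\mathbb Q)$ with $\langle x,x'\rangle>\theta\|x\|\|x'\|$ for some $x\in V_{\rm h}$, and $N^\infty=\bigcup_{k\in\mathbb Z}A^k(N)$, where for $k<0$ the set $A^{k}(N)$ is the preimage of $N$ under $A^{-k}$. (3) If $V_{\rm qf}\neq\{0\}$, then there is a Nielsen 1-chain $\rho$ such that every $x\in V_{\rm qf}$ is of the form $q_1g_1\rho+\dots+q_rg_r\rho$ with $q_i\in\mathbb Q$, $g_i\in\mathbb F$. Let $C_1^{(2)}(\widetilde\Gamma,\widetilde H)$ be the Hilbert space of square-summable complex 1-chains on the edges of $\widetilde\Gamma$ outside $\widetilde H$;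 it is isomorphic to $L^2(\mathbb F)^{n_H}$, where $n_H$ is the number of edges of $\Gamma$ outside $H$. Let $V_{\rm qf}^{(2)}$ be the closure in it of the complex span of $V_{\rm qf}$. For a bounded operator $B$ on a Hilbert space $\mathcal H$ and $\nu>0$ let $$\mathfrak E(B,\nu)=\{\xi\in\mathcal H:\exists(\xi_j)\subset\mathcal H,\ \xi_j\to\xi,\ \limsup_{j\to\infty}\|B^j\xi_j\|^{1/j}\le\nu\},$$ $$\mathfrak F(B,\nu)=\{\xi\in\mathcal H:\exists(\xi_j)\subset\mathcal H,\ B^j\xi_j\to\xi,\ \limsup_{j\to\infty}\|\xi_j\|^{1/j}\le\nu^{-1}\}.$$ Then $A_{f,H}$ extends uniquely to a bounded operator on $C_1^{(2)}(\widetilde\Gamma,\widetilde H)$, again denoted $A_{f,H}$, and there is a constant $\lambda>1$ such that for all $1\le\nu<\lambda$ $$V_{\rm qf}^{(2)}=\mathfrak E(A_{f,H},\nu)\cap\mathfrak F(A_{f,H},\nu^{-1}).$$ -/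

import Mathlib

open CategoryTheory
open scoped ENNReal

universe u v

noncomputable section

namespace ChainFlare

/-! ### Graphs, morphisms of graphs and homotopy equivalences

A graph is a quiver: objects are vertices and arrows are the (oriented) edges.  The free
groupoid on the quiver is the fundamental groupoid of the graph: its arrows are the homotopy
classes rel endpoints of edge-paths. -/

section Graphs

variable (V : Type u) [Quiver.{v} V]

/-- The fundamental groupoid of the graph. -/
abbrev Pi1 : Type u := Quiver.FreeGroupoid V

variable {V}

/-- Edge-paths starting at the vertex `a`: concatenations of edges and reversed edges. -/
inductive EdgePath (a : V) : V → Type (max u v)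
  | nil : EdgePath a a
  | forward {b c : V} (p : EdgePath a b) (e : b ⟶ c) : EdgePath a c
  | backward {b c : V} (p : EdgePath a b) (e : c ⟶ b) : EdgePath a c

variable (V) in
/-- A morphism of a graph to itself: vertices go to vertices and each edge goes to an edge-path. -/
structure GraphMap where
  obj : V → V
  map : ∀ {a b : V}, (a ⟶ b) → EdgePath (obj a) (obj b)

/-- A vertex, as an object of the fundamental groupoid. -/
abbrev pt (a : V) : Pi1 V := (Quiver.FreeGroupoid.of V).obj a

/-- The homotopy classes rel endpoints of edge-paths from `a` to `b`. -/
abbrev PathClass (a b : V) : Type (max u v) :=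
  @Quiver.Hom (Pi1 V) CategoryStruct.toQuiver (pt a) (pt b)

/-- The homotopy class rel endpoints of an edge. -/
abbrev edgeClass {a b : V} (e : a ⟶ b) : PathClass a b := (Quiver.FreeGroupoid.of V).map e

/-- The homotopy class rel endpoints of an edge-path. -/
def pathClass {a : V} : ∀ {b : V}, EdgePath a b → PathClass a b
  | _, .nil => 𝟙 (pt a)
  | _, .forward p e => pathClass p ≫ edgeClass e
  | _, .backward p e => pathClass p ≫ Groupoid.inv (edgeClass e)

/-- The functor induced on fundamental groupoids by a morphism of the graph. -/
def GraphMap.induced (f : GraphMap V) : Pi1 V ⥤ Pi1 V :=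
  Quiver.FreeGroupoid.lift
    { obj := fun a => pt (f.obj a)
      map := fun e => pathClass (f.map e) }

/-- The induced functor on arrows. -/
def GraphMap.mapClass (f : GraphMap V) {a b : V} (p : PathClass a b) :
    PathClass (f.obj a) (f.obj b) :=
  f.induced.map p

/-- `f` is a homotopy equivalence.  A homotopy between two morphisms of a graph is, up to homotopy
rel endpoints, a choice for each vertex of a path between its two images that is compatible with
the images of all edges; this is an isomorphism of the induced functors. -/
def GraphMap.IsHomotopyEquiv (f : GraphMap V) : Prop :=
  ∃ g : GraphMap V, Nonempty (f.induced ⋙ g.induced ≅ 𝟭 (Pi1 V)) ∧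
    Nonempty (g.induced ⋙ f.induced ≅ 𝟭 (Pi1 V))

variable (V)

/-- A subgraph. -/
structure Subgraph where
  verts : Set V
  edges : ∀ {a b : V}, Set (a ⟶ b)
  src_mem : ∀ {a b : V} {e : a ⟶ b}, e ∈ edges → a ∈ verts
  tgt_mem : ∀ {a b : V} {e : a ⟶ b}, e ∈ edges → b ∈ verts

variable {V}

/-- The edge-path only crosses edges of `H` (in either direction) and starts in `H`. -/
def Subgraph.ContainsPath (H : Subgraph V) {a : V} : ∀ {b : V}, EdgePath a b → Prop
  | _, .nil => a ∈ H.verts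
  | _, .forward p e => H.ContainsPath p ∧ e ∈ H.edges
  | _, .backward p e => H.ContainsPath p ∧ e ∈ H.edges

/-- `f(H) ⊆ H`. -/
def Subgraph.IsInvariant (H : Subgraph V) (f : GraphMap V) : Prop :=
  (∀ a ∈ H.verts, f.obj a ∈ H.verts) ∧
    ∀ (a b : V) (e : a ⟶ b), e ∈ H.edges → H.ContainsPath (f.map e)

end Graphs

/-! ### The universal cover

The universal cover of the graph based at the vertex `x`: a vertex is a homotopy class of
edge-paths starting at `x`, and an edge is an edge of the graph together with a lift of its initial
vertex.  The fundamental group at `x` is the set of loops `PathClass x x` with concatenation `≫` as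
product; it acts on the left by concatenation. -/

section Cover

variable {V : Type u} [Quiver.{v} V]

/-- The vertices of the universal cover. -/
@[ext]
structure CoverVertex (x : V) where
  base : V
  path : PathClass x base

/-- The edges of the universal cover; `path` is the initial vertex. -/
@[ext]
structure CoverEdge (x : V) where
  src : V
  tgt : V
  edge : src ⟶ tgt
  path : PathClass x src

variable {x : V}

def CoverEdge.initial (e : CoverEdge x) : CoverVertex x := ⟨e.src, e.path⟩

def CoverEdge.terminal (e : CoverEdge x) : CoverVertex x := ⟨e.tgt, e.path ≫ edgeClass e.edge⟩

/-- The action of the fundamental group on the edges of the universal cover. -/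
def CoverEdge.translate (g : PathClass x x) (e : CoverEdge x) : CoverEdge x :=
  ⟨e.src, e.tgt, e.edge, g ≫ e.path⟩

/-- Rational cellular `1`-chains of the universal cover. -/
abbrev Chain1 (x : V) := CoverEdge x →₀ ℚ

/-- Rational cellular `0`-chains of the universal cover. -/
abbrev Chain0 (x : V) := CoverVertex x →₀ ℚ

/-- The boundary map, `e ↦ t(e) - o(e)`. -/
def boundary : Chain1 x →ₗ[ℚ] Chain0 x :=
  Finsupp.linearCombination ℚ fun e =>
    Finsupp.single e.terminal (1 : ℚ) - Finsupp.single e.initial 1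

/-- The `1`-chain of the lift to the universal cover, with initial vertex `s`, of an edge-path. -/
def pathChain {a : V} (s : PathClass x a) : ∀ {b : V}, EdgePath a b → Chain1 x
  | _, .nil => 0
  | _, .forward (b := b) (c := c) p e =>
      pathChain s p + Finsupp.single ⟨b, c, e, s ≫ pathClass p⟩ 1
  | _, .backward (b := b) (c := c) p e =>
      pathChain s p - Finsupp.single ⟨c, b, e, s ≫ pathClass p ≫ Groupoid.inv (edgeClass e)⟩ 1

/-- For `f` fixing `x`, the action of the lift of `f` that fixes the base point of the universal
cover on (paths representing) vertices of the universal cover. -/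
def liftPath (f : GraphMap V) (hx : f.obj x = x) {a : V} (p : PathClass x a) :
    PathClass x (f.obj a) :=
  eqToHom (congrArg (fun a : V => pt a) hx.symm) ≫ f.mapClass p

/-- The lift of `f` on vertices of the universal cover. -/
def liftVertex (f : GraphMap V) (hx : f.obj x = x) (w : CoverVertex x) : CoverVertex x :=
  ⟨f.obj w.base, liftPath f hx w.path⟩

/-- The map induced on `1`-chains by the lift of `f`. -/
def chainMap (f : GraphMap V) (hx : f.obj x = x) : Chain1 x →ₗ[ℚ] Chain1 x :=
  Finsupp.linearCombination ℚ fun e => pathChain (liftPath f hx e.path) (f.map e.edge)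

end Cover

/-! ### Relative chains -/

section Relative

variable {V : Type u} [Quiver.{v} V]

/-- The edges of the universal cover that do not project to edges of `H`. -/
abbrev RelEdge (H : Subgraph V) (x : V) := {e : CoverEdge x // e.edge ∉ H.edges}

/-- The relative rational `1`-chains, i.e. those supported on the edges outside the preimage
of `H`. -/
abbrev RelChain (H : Subgraph V) (x : V) := RelEdge H x →₀ ℚ

variable {H : Subgraph V} {x : V}

def RelEdge.translate (g : PathClass x x) (e : RelEdge H x) : RelEdge H x :=
  ⟨e.1.translate g, e.2⟩

/-- The action of the fundamental group on relative chains, `e ↦ g e` on edges. -/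
def RelChain.translate (g : PathClass x x) : RelChain H x →ₗ[ℚ] RelChain H x :=
  Finsupp.lmapDomain ℚ ℚ (RelEdge.translate g)

variable (H x) in
/-- The inclusion of relative chains into all chains. -/
def relIncl : RelChain H x →ₗ[ℚ] Chain1 x := Finsupp.lmapDomain ℚ ℚ Subtype.val

variable (H x) in
/-- The projection of chains onto relative chains, forgetting the coefficients of edges over
`H`. -/
def relProj : Chain1 x →ₗ[ℚ] RelChain H x :=
  Finsupp.lcomapDomain (Subtype.val : RelEdge H x → CoverEdge x) Subtype.val_injective

variable (H) in
/-- The map `A_{f,H}` on relative rational chains. -/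
def relMap (f : GraphMap V) (hx : f.obj x = x) : RelChain H x →ₗ[ℚ] RelChain H x :=
  relProj H x ∘ₗ chainMap f hx ∘ₗ relIncl H x

/-- The usual inner product of chains. -/
def chainInner (c d : RelChain H x) : ℝ := ∑ e ∈ c.support, (c e : ℝ) * (d e : ℝ)

/-- The usual `L²`-norm of chains. -/
def chainNorm (c : RelChain H x) : ℝ := √(chainInner c c)

/-- `ρ` is the relative chain of the edge-path between two distinct vertices of the universal cover
that are fixed by the lift of `f`. -/
def IsFixedPathChain (f : GraphMap V) (hx : f.obj x = x) (ρ : RelChain H x) : Prop :=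
  ∃ (w w' : CoverVertex x) (c : Chain1 x), w ≠ w' ∧
    liftVertex f hx w = w ∧ liftVertex f hx w' = w' ∧
    boundary c = Finsupp.single w' 1 - Finsupp.single w 1 ∧ ρ = relProj H x c

/-- The condition that distinguishes non-geometric Nielsen `1`-chains. -/
def IsNonGeometric (ρ : RelChain H x) : Prop :=
  ∃ e : RelEdge H x, (ρ e = 1 ∨ ρ e = -1) ∧
    ∀ g : PathClass x x, g ≠ 𝟙 (pt x) → ρ (e.translate g) = 0

/-- The support of the translate `gρ`. -/
def suppTranslate (g : PathClass x x) (ρ : RelChain H x) : Set (RelEdge H x) :=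
  {e | RelChain.translate g ρ e ≠ 0}

/-- The conditions that distinguish geometric Nielsen `1`-chains. -/
structure IsGeometric (ρ : RelChain H x) : Prop where
  /-- The supports of two different translates share at most one edge. -/
  single : ∀ g₁ g₂ : PathClass x x, g₁ ≠ g₂ →
    (suppTranslate g₁ ρ ∩ suppTranslate g₂ ρ).Subsingleton
  /-- Every edge is the common edge of exactly one pair of different translates. -/
  pair : ∀ e : RelEdge H x, ∃ g₁ g₂ : PathClass x x, g₁ ≠ g₂ ∧
    suppTranslate g₁ ρ ∩ suppTranslate g₂ ρ = {e} ∧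
    ∀ h₁ h₂ : PathClass x x, h₁ ≠ h₂ → suppTranslate h₁ ρ ∩ suppTranslate h₂ ρ = {e} →
      (h₁ = g₁ ∧ h₂ = g₂) ∨ (h₁ = g₂ ∧ h₂ = g₁)
  noncommuting : ∃ g₁ g₂ : PathClass x x, g₁ ≫ g₂ ≠ g₂ ≫ g₁ ∧
    (suppTranslate (𝟙 (pt x)) ρ ∩ suppTranslate g₁ ρ).Nonempty ∧
    (suppTranslate (𝟙 (pt x)) ρ ∩ suppTranslate g₂ ρ).Nonempty

/-- Nielsen `1`-chains. -/
def IsNielsenChain (f : GraphMap V) (hx : f.obj x = x) (ρ : RelChain H x) : Prop :=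
  IsFixedPathChain f hx ρ ∧ (IsNonGeometric ρ ∨ IsGeometric ρ)

/-! ### The chain flare condition -/

/-- `N_θ(W)`: the chains that make a small angle with some element of `W`. -/
def angleNhd (θ : ℝ) (W : Submodule ℚ (RelChain H x)) : Set (RelChain H x) :=
  {d | ∃ c ∈ W, chainInner c d > θ * chainNorm c * chainNorm d}

/-- `⋃ₖ Aᵏ(N)` over all integers `k`; for negative `k` this is the preimage of `N` under `A⁻ᵏ`. -/
def orbitSet {M : Type*} (A : M → M) (N : Set M) : Set M :=
  ⋃ k : ℕ, (A^[k] '' N ∪ A^[k] ⁻¹' N)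

/-- A rational subspace is a submodule over the rational group ring of the fundamental group. -/
def IsGroupInvariant (W : Submodule ℚ (RelChain H x)) : Prop :=
  ∀ (g : PathClass x x), ∀ c ∈ W, RelChain.translate g c ∈ W

/-- `f` satisfies the chain flare condition relative to `H` with hyperbolic submodule `Vh` and
quasi-fixed submodule `Vqf`. -/
structure ChainFlareCondition (f : GraphMap V) (hx : f.obj x = x)
    (Vh Vqf : Submodule ℚ (RelChain H x)) : Prop where
  invariant_h : IsGroupInvariant Vh
  invariant_qf : IsGroupInvariant Vqf
  sum_eq_top : Vh ⊔ Vqf = ⊤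
  flare : ∃ lam θ : ℝ, 1 < lam ∧ 0 < θ ∧ θ < 1 ∧
    ∀ c ∈ orbitSet (relMap H f hx) (angleNhd θ Vh),
      lam * chainNorm (relMap H f hx c) ≤
        max (chainNorm (relMap H f hx (relMap H f hx c))) (chainNorm c)
  quasi_fixed : Vqf ≠ ⊥ → ∃ ρ : RelChain H x, IsNielsenChain f hx ρ ∧
    ∀ c ∈ Vqf, c ∈ Submodule.span ℚ (Set.range fun g : PathClass x x => RelChain.translate g ρ)

/-! ### `L²`-chains -/

variable (H x) in
/-- The Hilbert space of complex square-summable relative `1`-chains.  As the fundamental group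
acts freely on the edges of the universal cover with `n_H` orbits outside the preimage of `H`, a
choice of orbit representatives identifies it with `L²(𝔽)^{n_H}`. -/
abbrev L2Chain := lp (fun _ : RelEdge H x => ℂ) 2

/-- A rational chain, as an `L²`-chain. -/
def toL2 (c : RelChain H x) : L2Chain H x :=
  ⟨fun e => ((c e : ℚ) : ℂ), by
    refine memℓp_gen (summable_of_hasFiniteSupport ?_)
    refine c.hasFiniteSupport.subset fun e he => ?_
    contrapose! he
    simp [Function.notMem_support.mp he]⟩

/-- The Hilbert module of `W`: the closed complex subspace generated by `W`. -/
def l2Closure (W : Submodule ℚ (RelChain H x)) : Submodule ℂ (L2Chain H x) :=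
  (Submodule.span ℂ (toL2 '' (W : Set (RelChain H x)))).topologicalClosure

/-- The bounded operator `A` is the extension of `A_{f,H}` to `L²`-chains. -/
def IsL2Extension (f : GraphMap V) (hx : f.obj x = x) (A : L2Chain H x →L[ℂ] L2Chain H x) : Prop :=
  ∀ c : RelChain H x, A (toL2 c) = toL2 (relMap H f hx c)

end Relative

/-! ### Haagerup–Schultz subspaces -/

section HaagerupSchultz

variable {E : Type*} [NormedAddCommGroup E] [InnerProductSpace ℂ E]

/-- `𝔈(A, ν)`. -/
def subspaceE (A : E →L[ℂ] E) (ν : ℝ) : Set E :=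
  {ξ | ∃ s : ℕ → E, Filter.Tendsto s Filter.atTop (nhds ξ) ∧
    Filter.limsup (fun j : ℕ => ‖(A ^ j) (s j)‖ₑ ^ (1 / (j : ℝ))) Filter.atTop
      ≤ ENNReal.ofReal ν}

/-- `𝔉(A, ν)`. -/
def subspaceF (A : E →L[ℂ] E) (ν : ℝ) : Set E :=
  {ξ | ∃ s : ℕ → E, Filter.Tendsto (fun j : ℕ => (A ^ j) (s j)) Filter.atTop (nhds ξ) ∧
    Filter.limsup (fun j : ℕ => ‖s j‖ₑ ^ (1 / (j : ℝ))) Filter.atTop ≤ ENNReal.ofReal ν⁻¹}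

end HaagerupSchultz

end ChainFlare

end

/-! The constant is the flare constant `lam` itself. For the inclusion of `Vqf`: the chain joining
two fixed vertices is determined by its boundary, because the universal cover has no cycles, so A
fixes ρ (`relMap_eq_self_of_isFixedPathChain`). A is equivariant only up to the automorphism φ =
`groupMap` of the fundamental group, hence Aʲ(gρ) = φʲ(g)ρ. As φ is bijective, gρ has a bounded
forward orbit and bounded preimages under all powers. The sequences in the definitions of 𝔈 and 𝔉
may vary with j, so both sets contain the closure of such vectors when ν ≥ 1.

Conversely, a vector ξ of the intersection is slow: it is a limit of vectors whose images,
respectively preimages, under Aʲ are o(lamʲ). A bounded operator P extends a choice of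
`Vh`-components (`exists_clm_of_sup_eq_top`). Then ξ - Pξ lies in the closure for `Vqf`, so it is
slow by the first inclusion, and Pξ is slow too. It remains to see that a slow η in the closure of
`Vh` vanishes (`eq_zero_of_isSlow`). Along an orbit through the cone around `Vh`, a step that does
not contract by `lam` forces all later steps to expand by `lam`. If η ≠ 0, approximation by rational
chains therefore gives lam‖Aη‖ ≤ ‖η‖ from forward slowness and lam‖η‖ ≤ ‖Aη‖ from backward slowness,
which is absurd.

The flare inequality concerns rational chains, whose closure consists of the real families only.
Since A and P commute with conjugation, real and imaginary parts can be treated separately. -/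

noncomputable section

namespace ChainFlare

/-! ### Path classes and functoriality. -/

section FundamentalGroupoid

variable {V : Type u} [Quiver.{v} V]

/-- Every homotopy class is represented by an edge-path. -/
theorem pathClass_surjective {a b : V} (p : PathClass a b) :
    ∃ q : EdgePath a b, pathClass q = p := by
  induction p using Quot.inductionOn with | _ p =>
  change Quiver.Path (V := Quiver.Symmetrify V) a b at p
  induction p with
  | nil => exact ⟨.nil, rfl⟩
  | cons p e ih =>
    obtain ⟨q, hq⟩ := ih
    rcases e with e | e
    · exact ⟨.forward q e, by rw [pathClass, hq]; rfl⟩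
    · exact ⟨.backward q e, by rw [pathClass, hq]; rfl⟩

theorem GraphMap.mapClass_comp (f : GraphMap V) {a b c : V} (p : PathClass a b)
    (q : PathClass b c) : f.mapClass (p ≫ q) = f.mapClass p ≫ f.mapClass q :=
  f.induced.map_comp p q

theorem GraphMap.mapClass_edgeClass (f : GraphMap V) {a b : V} (e : a ⟶ b) :
    f.mapClass (edgeClass e) = pathClass (f.map e) := by
  change 𝟙 _ ≫ pathClass (f.map e) = _
  exact Category.id_comp _

theorem GraphMap.IsHomotopyEquiv.isEquivalence {f : GraphMap V} (hf : f.IsHomotopyEquiv) :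
    f.induced.IsEquivalence := by
  obtain ⟨g, ⟨i⟩, ⟨j⟩⟩ := hf
  exact (CategoryTheory.Equivalence.mk f.induced g.induced i.symm j).isEquivalence_functor

end FundamentalGroupoid

/-! ### The universal cover is a tree. -/

section Tree

variable {V : Type u} [Quiver.{v} V] {x : V}

/-- Parallel transport along an edge for the crossed homomorphism of `liftedChain`. -/
def edgeTransport (x : V) {a b : V} (e : a ⟶ b) :
    (PathClass x a × Chain1 x) ≅ (PathClass x b × Chain1 x) :=
  Equiv.toIso
    { toFun := fun z => (z.1 ≫ edgeClass e, z.2 + Finsupp.single ⟨a, b, e, z.1⟩ 1)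
      invFun := fun z => (z.1 ≫ Groupoid.inv (edgeClass e),
        z.2 - Finsupp.single ⟨a, b, e, z.1 ≫ Groupoid.inv (edgeClass e)⟩ 1)
      left_inv := fun z => by simp
      right_inv := fun z => by simp }

/-- Transport of (path, chain) pairs along path classes. -/
def transport (x : V) : Pi1 V ⥤ Core (Type (max u v)) :=
  Quiver.FreeGroupoid.lift
    { obj := fun a => ⟨PathClass x a × Chain1 x⟩
      map := fun e => ⟨edgeTransport x e⟩ }

def transportMap {a b : V} (p : PathClass a b) (z : PathClass x a × Chain1 x) :
    PathClass x b × Chain1 x :=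
  ((transport x).map p).iso.hom z

theorem transportMap_comp {a b c : V} (p : PathClass a b) (q : PathClass b c)
    (z : PathClass x a × Chain1 x) :
    transportMap (p ≫ q) z = transportMap q (transportMap p z) := by
  have := (transport x).map_comp p q
  unfold transportMap
  rw [this]; rfl

theorem transportMap_id {a : V} (z : PathClass x a × Chain1 x) :
    transportMap (𝟙 (pt a)) z = z := by
  have := (transport x).map_id (pt a)
  unfold transportMap
  rw [this]; rfl

theorem transportMap_edgeClass {a b : V} (e : a ⟶ b) (z : PathClass x a × Chain1 x) :
    transportMap (edgeClass e) z =
      (z.1 ≫ edgeClass e, z.2 + Finsupp.single ⟨a, b, e, z.1⟩ 1) := rfl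

theorem transportMap_fst {a b : V} (p : PathClass a b) (z : PathClass x a × Chain1 x) :
    (transportMap p z).1 = z.1 ≫ p := by
  obtain ⟨q, rfl⟩ := pathClass_surjective p
  induction q with
  | nil => rw [pathClass, transportMap_id, Category.comp_id]
  | forward q e ih => rw [pathClass, transportMap_comp, transportMap_edgeClass, ih, Category.assoc]
  | @backward b c q e ih =>
    -- Transport is explicit only along forward edges, so the reversed edge is followed by the edge
    -- itself and then cancelled.
    have h : transportMap (pathClass q) z = transportMap (edgeClass e)
        (transportMap (pathClass (.backward q e)) z) := by
      rw [← transportMap_comp, pathClass, Category.assoc, Groupoid.inv_comp, Category.comp_id]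
    have h1 := congrArg Prod.fst h
    rw [ih, transportMap_edgeClass] at h1
    simp only at h1
    rw [pathClass, ← Category.assoc, h1]
    simp [pathClass]

/-- The chain of the path in the universal cover from the base point to a vertex. -/
def liftedChain (w : CoverVertex x) : Chain1 x :=
  (transportMap w.path (𝟙 (pt x), 0)).2

/-- This makes the linear extension of `liftedChain` to 0-chains a left inverse of `boundary`. -/
theorem liftedChain_terminal (e : CoverEdge x) :
    liftedChain e.terminal = liftedChain e.initial + Finsupp.single e 1 := by
  unfold liftedChain CoverEdge.terminal CoverEdge.initial
  simp only
  rw [transportMap_comp, transportMap_edgeClass]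
  simp only
  rw [transportMap_fst, Category.id_comp]

/-- The universal cover of a graph has no cycles. -/
theorem boundary_injective : Function.Injective (boundary (x := x)) := by
  have h : (Finsupp.linearCombination ℚ (liftedChain (x := x))) ∘ₗ boundary = LinearMap.id := by
    ext1 e
    ext1
    simp [boundary, liftedChain_terminal]
  exact Function.LeftInverse.injective (g := Finsupp.linearCombination ℚ (liftedChain (x := x)))
    fun c => LinearMap.congr_fun h c

end Tree

/-! ### The lift of `f`: twisted equivariance and the chain map. -/

section Lift

variable {V : Type u} [Quiver.{v} V] {x : V} (f : GraphMap V) (hx : f.obj x = x)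

/-- The endomorphism of the fundamental group induced by `f`. -/
def groupMap (g : PathClass x x) : PathClass x x :=
  liftPath f hx g ≫ eqToHom (congrArg (fun a : V => pt a) hx)

theorem liftPath_comp {a b : V} (p : PathClass x a) (q : PathClass a b) :
    liftPath f hx (p ≫ q) = liftPath f hx p ≫ f.mapClass q := by
  rw [liftPath, GraphMap.mapClass_comp, ← Category.assoc]; rfl

theorem liftPath_group_comp {a : V} (g : PathClass x x) (p : PathClass x a) :
    liftPath f hx (g ≫ p) = groupMap f hx g ≫ liftPath f hx p := by
  rw [liftPath_comp, groupMap, liftPath.eq_def f hx p]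
  simp

/-- An equivalence of groupoids is fully faithful; the `eqToHom` factors only account for the
identification of `f.obj x` with `x`. -/
theorem groupMap_bijective (hf : f.IsHomotopyEquiv) : Function.Bijective (groupMap f hx) := by
  have := hf.isEquivalence
  constructor
  · intro g h hgh
    unfold groupMap liftPath at hgh
    rw [cancel_mono, cancel_epi] at hgh
    exact f.induced.map_injective hgh
  · intro g
    obtain ⟨h, hh⟩ := f.induced.map_surjective (X := pt x) (Y := pt x)
      (eqToHom (congrArg (fun a : V => pt a) hx) ≫ g ≫
        eqToHom (congrArg (fun a : V => pt a) hx.symm))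
    refine ⟨h, ?_⟩
    have hh' : f.mapClass h = eqToHom (congrArg (fun a : V => pt a) hx) ≫ g ≫
        eqToHom (congrArg (fun a : V => pt a) hx.symm) := hh
    rw [groupMap, liftPath, hh']
    simp

theorem boundary_pathChain {a b : V} (s : PathClass x a) (p : EdgePath a b) :
    boundary (pathChain s p) =
      Finsupp.single ⟨b, s ≫ pathClass p⟩ 1 - Finsupp.single ⟨a, s⟩ 1 := by
  induction p with
  | nil => simp [pathChain, pathClass]
  | forward p e ih =>
    rw [pathChain, map_add, ih]
    simp [boundary, CoverEdge.terminal, CoverEdge.initial, pathClass]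
  | backward p e ih =>
    rw [pathChain, map_sub, ih]
    simp [boundary, CoverEdge.terminal, CoverEdge.initial, pathClass]

/-- The lift of `f` induces a chain map. -/
theorem boundary_chainMap (c : Chain1 x) :
    boundary (chainMap f hx c) = Finsupp.lmapDomain ℚ ℚ (liftVertex f hx) (boundary c) := by
  suffices boundary ∘ₗ chainMap f hx = Finsupp.lmapDomain ℚ ℚ (liftVertex f hx) ∘ₗ boundary from
    LinearMap.congr_fun this c
  ext1 e
  ext1
  simp [boundary_pathChain, chainMap]
  simp [boundary, liftVertex, CoverEdge.terminal, CoverEdge.initial, liftPath_comp,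
    GraphMap.mapClass_edgeClass, Finsupp.mapDomain_sub]

/-- The image has the same boundary as the chain, and a tree has no 1-cycles. -/
theorem chainMap_eq_self {w w' : CoverVertex x} {c : Chain1 x} (hw : liftVertex f hx w = w)
    (hw' : liftVertex f hx w' = w')
    (hc : boundary c = Finsupp.single w' 1 - Finsupp.single w 1) : chainMap f hx c = c := by
  apply boundary_injective
  rw [boundary_chainMap, hc, map_sub]
  simp [hw, hw']

theorem pathChain_comp {a b : V} (g : PathClass x x) (s : PathClass x a) (p : EdgePath a b) :
    pathChain (g ≫ s) p = Finsupp.lmapDomain ℚ ℚ (CoverEdge.translate g) (pathChain s p) := by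
  induction p with
  | nil => simp [pathChain]
  | forward p e ih => simp [pathChain, ih, Finsupp.mapDomain_add, CoverEdge.translate]
  | backward p e ih => simp [pathChain, ih, Finsupp.mapDomain_sub, CoverEdge.translate]

end Lift

/-! ### Passing to chains relative to `H`. -/

section RelativeLift

variable {V : Type u} [Quiver.{v} V] {x : V} {H : Subgraph V}

theorem relEdge_translate_injective (g : PathClass x x) :
    Function.Injective (RelEdge.translate (H := H) g) := by
  rintro ⟨⟨a, b, e, p⟩, he⟩ ⟨⟨a', b', e', p'⟩, he'⟩ h
  simp only [RelEdge.translate, CoverEdge.translate, Subtype.mk.injEq, CoverEdge.mk.injEq] at h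
  obtain ⟨rfl, rfl, h1, h2⟩ := h
  obtain rfl := eq_of_heq h1
  rw [(cancel_epi g).1 (eq_of_heq h2)]

theorem relEdge_translate_right_injective (e : RelEdge H x) :
    Function.Injective fun g : PathClass x x => RelEdge.translate g e := by
  intro g h hgh
  simp only [RelEdge.translate, CoverEdge.translate, Subtype.mk.injEq, CoverEdge.mk.injEq,
    heq_eq_eq, true_and] at hgh
  exact (cancel_mono e.1.path).1 hgh

theorem relProj_single_of_notMem {e : CoverEdge x} (he : e.edge ∉ H.edges) (q : ℚ) :
    relProj H x (Finsupp.single e q) = Finsupp.single ⟨e, he⟩ q := by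
  ext e'
  classical
  simp [relProj, Finsupp.single_apply, Subtype.ext_iff]

theorem relProj_single_of_mem {e : CoverEdge x} (he : e.edge ∈ H.edges) (q : ℚ) :
    relProj H x (Finsupp.single e q) = 0 := by
  ext e'
  have : e ≠ e'.1 := by rintro rfl; exact e'.2 he
  simp [relProj, this]

theorem relProj_translate (g : PathClass x x) (c : Chain1 x) :
    relProj H x (Finsupp.lmapDomain ℚ ℚ (CoverEdge.translate g) c) =
      RelChain.translate g (relProj H x c) := by
  induction c using Finsupp.induction_linear with
  | zero => simp
  | add c d hc hd => simp only [map_add, hc, hd]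
  | single e q =>
    by_cases he : e.edge ∈ H.edges
    · rw [relProj_single_of_mem he, Finsupp.lmapDomain_apply, Finsupp.mapDomain_single,
        relProj_single_of_mem (by exact he), map_zero]
    · rw [relProj_single_of_notMem he, Finsupp.lmapDomain_apply, Finsupp.mapDomain_single,
        relProj_single_of_notMem (by exact he), RelChain.translate, Finsupp.lmapDomain_apply,
        Finsupp.mapDomain_single]
      rfl

/-- The lift of `f` carries the initial vertex of a translated edge to the `groupMap`-translate of
its image, and edge-paths are lifted equivariantly. -/
theorem relMap_translate (f : GraphMap V) (hx : f.obj x = x) (g : PathClass x x)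
    (c : RelChain H x) :
    relMap H f hx (RelChain.translate g c) =
      RelChain.translate (groupMap f hx g) (relMap H f hx c) := by
  induction c using Finsupp.induction_linear with
  | zero => simp
  | add c d hc hd => simp only [map_add, hc, hd]
  | single e q =>
    simp only [relMap, RelChain.translate, Finsupp.lmapDomain_apply, Finsupp.mapDomain_single,
      LinearMap.comp_apply, relIncl, chainMap, Finsupp.linearCombination_single, map_smul]
    congr 1
    have := relProj_translate (H := H) (groupMap f hx g)
      (pathChain (liftPath f hx e.1.path) (f.map e.1.edge))
    rw [← pathChain_comp, ← liftPath_group_comp] at this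
    exact this

theorem relProj_pathChain_eq_zero {a b : V} (s : PathClass x a) (p : EdgePath a b)
    (hp : H.ContainsPath p) : relProj H x (pathChain s p) = 0 := by
  induction p with
  | nil => simp [pathChain]
  | forward p e ih =>
    rw [pathChain, map_add, ih hp.1, relProj_single_of_mem hp.2, add_zero]
  | backward p e ih =>
    rw [pathChain, map_sub, ih hp.1, relProj_single_of_mem hp.2, sub_zero]

/-- Invariance of `H` enters here: edges over `H` map to paths over `H`, so discarding them before
or after applying `f` makes no difference. -/
theorem relMap_relProj (f : GraphMap V) (hx : f.obj x = x) (hH : H.IsInvariant f)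
    (c : Chain1 x) : relMap H f hx (relProj H x c) = relProj H x (chainMap f hx c) := by
  induction c using Finsupp.induction_linear with
  | zero => simp
  | add c d hc hd => simp only [map_add, hc, hd]
  | single e q =>
    by_cases he : e.edge ∈ H.edges
    · rw [relProj_single_of_mem he, map_zero, chainMap, Finsupp.linearCombination_single, map_smul,
        relProj_pathChain_eq_zero _ _ (hH.2 _ _ _ he), smul_zero]
    · rw [relProj_single_of_notMem he]
      simp [relMap, relIncl]

theorem relMap_eq_self_of_isFixedPathChain {f : GraphMap V} {hx : f.obj x = x}
    (hH : H.IsInvariant f) {ρ : RelChain H x} (hρ : IsFixedPathChain f hx ρ) :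
    relMap H f hx ρ = ρ := by
  obtain ⟨w, w', c, -, hw, hw', hc, rfl⟩ := hρ
  rw [relMap_relProj f hx hH, chainMap_eq_self f hx hw hw' hc]

end RelativeLift

/-! ### Operators on square-summable families -/

section SquareSummable

variable {ι κ : Type*}

theorem memℓp_comp_injective {u : κ → ι} (hu : Function.Injective u)
    (y : lp (fun _ : ι => ℂ) 2) : Memℓp (fun k => y (u k)) 2 := by
  refine memℓp_gen ?_
  exact (lp.memℓp y).summable (by norm_num) |>.comp_injective hu

/-- Pulling back square-summable families along an injective map. -/
def lpComap (u : κ → ι) (hu : Function.Injective u) :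
    lp (fun _ : ι => ℂ) 2 →L[ℂ] lp (fun _ : κ => ℂ) 2 :=
  LinearMap.mkContinuous
    { toFun := fun y => ⟨fun k => y (u k), memℓp_comp_injective hu y⟩
      map_add' := fun _ _ => rfl
      map_smul' := fun _ _ => rfl } 1 fun y => by
    have h2 : 0 < (2 : ℝ≥0∞).toReal := by norm_num
    rw [one_mul]
    refine lp.norm_le_of_tsum_le h2 (norm_nonneg y) ?_
    rw [lp.norm_rpow_eq_tsum h2]
    have hs := (lp.memℓp y).summable h2
    exact (hs.comp_injective hu).tsum_le_tsum_of_inj u hu (fun _ _ => by positivity)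
      (fun _ => le_rfl) hs

@[simp]
theorem lpComap_apply (u : κ → ι) (hu : Function.Injective u) (y : lp (fun _ : ι => ℂ) 2) (k : κ) :
    lpComap u hu y k = y (u k) := rfl

theorem lpComap_single [DecidableEq ι] [DecidableEq κ] (u : κ → ι) (hu : Function.Injective u)
    (k : κ) (z : ℂ) :
    lpComap u hu (lp.single 2 (u k) z) = lp.single 2 k z := by
  ext k'
  simp [Pi.single_apply, hu.eq_iff]

theorem lpComap_single_of_notMem [DecidableEq ι] (u : κ → ι) (hu : Function.Injective u)
    {i : ι} (hi : ∀ k, u k ≠ i) (z : ℂ) : lpComap u hu (lp.single 2 i z) = 0 := by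
  ext k'
  simp [hi]

/-- The adjoint of pulling back is extension by zero, which is thus bounded at no extra cost. -/
theorem adjoint_lpComap_single [DecidableEq ι] [DecidableEq κ] (u : κ → ι)
    (hu : Function.Injective u) (k : κ) (z : ℂ) :
    ContinuousLinearMap.adjoint (lpComap u hu) (lp.single 2 k z) = lp.single 2 (u k) z := by
  refine ext_inner_right ℂ fun y => ?_
  rw [ContinuousLinearMap.adjoint_inner_left, lp.inner_single_left, lp.inner_single_left]
  rfl

/-- A continuous additive map is determined by its values on the families with one entry. -/
theorem lp_addMonoidHom_ext [DecidableEq ι] {F : Type*} [AddCommMonoid F] [TopologicalSpace F] [T2Space F]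
    {S T : lp (fun _ : ι => ℂ) 2 →+ F} (hS : Continuous S) (hT : Continuous T)
    (h : ∀ i z, S (lp.single 2 i z) = T (lp.single 2 i z)) : S = T := by
  ext y
  have hy := lp.hasSum_single (p := 2) (by norm_num) y
  have h1 := hy.map S hS
  have h2 := hy.map T hT
  have h3 : (S ∘ fun i => lp.single 2 i (y i)) = T ∘ fun i => lp.single 2 i (y i) := by
    ext i; exact h i _
  rw [h3] at h1
  exact h1.unique h2

/-- The families with real entries. -/
def IsRealFamily (y : lp (fun _ : ι => ℂ) 2) : Prop := star y = y

/-- The real part of a square-summable family. -/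
def lpRe (y : lp (fun _ : ι => ℂ) 2) : lp (fun _ : ι => ℂ) 2 := (2⁻¹ : ℂ) • (y + star y)

theorem isRealFamily_lpRe (y : lp (fun _ : ι => ℂ) 2) : IsRealFamily (lpRe y) := by
  simp [IsRealFamily, lpRe, add_comm]

theorem norm_lpRe_le (y : lp (fun _ : ι => ℂ) 2) : ‖lpRe y‖ ≤ ‖y‖ := by
  rw [lpRe, norm_smul]
  have := norm_add_le y (star y)
  rw [norm_star] at this
  norm_num
  linarith

theorem continuous_lpRe : Continuous (lpRe (ι := ι)) := by
  unfold lpRe; fun_prop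

/-- The imaginary part is the real part of -iy, so statements about real families transfer to
complex ones. -/
theorem lpRe_add_I_smul (y : lp (fun _ : ι => ℂ) 2) :
    lpRe y + Complex.I • lpRe (-Complex.I • y) = y := by
  have hI : Complex.I * Complex.I = -1 := Complex.I_mul_I
  ext i
  change (2⁻¹ : ℂ) * (y i + star (y i)) +
    Complex.I * ((2⁻¹ : ℂ) * (-Complex.I * y i + star (-Complex.I * y i))) = y i
  simp only [star_mul', star_neg, Complex.star_def, Complex.conj_I]
  linear_combination (-(y i) / 2 + (starRingEnd ℂ) (y i) / 2) * hI

/-- Operators that commute with complex conjugation commute with taking real parts. -/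
theorem map_lpRe {A : lp (fun _ : ι => ℂ) 2 →L[ℂ] lp (fun _ : ι => ℂ) 2}
    (hA : ∀ y, A (star y) = star (A y)) (y : lp (fun _ : ι => ℂ) 2) :
    A (lpRe y) = lpRe (A y) := by
  simp [lpRe, hA]

theorem pow_lpRe {A : lp (fun _ : ι => ℂ) 2 →L[ℂ] lp (fun _ : ι => ℂ) 2}
    (hA : ∀ y, A (star y) = star (A y)) (j : ℕ) (y : lp (fun _ : ι => ℂ) 2) :
    (A ^ j) (lpRe y) = lpRe ((A ^ j) y) := by
  refine map_lpRe (fun y => ?_) y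
  induction j generalizing y with
  | zero => rfl
  | succ j ih => rw [pow_succ, mul_apply_eq_comp, hA, ih]; rfl

end SquareSummable

/-! ### Rational chains as square-summable chains -/

section RationalChains

variable {V : Type u} [Quiver.{v} V] {x : V} {H : Subgraph V}

@[simp]
theorem toL2_apply (c : RelChain H x) (e : RelEdge H x) : toL2 c e = ((c e : ℚ) : ℂ) := rfl

@[simp]
theorem toL2_zero : toL2 (0 : RelChain H x) = 0 := by ext e; simp

@[simp]
theorem toL2_add (c d : RelChain H x) : toL2 (c + d) = toL2 c + toL2 d := by ext e; simp

@[simp]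
theorem toL2_sub (c d : RelChain H x) : toL2 (c - d) = toL2 c - toL2 d := by ext e; simp

@[simp]
theorem toL2_smul (q : ℚ) (c : RelChain H x) : toL2 (q • c) = (q : ℂ) • toL2 c := by ext e; simp

theorem toL2_single [DecidableEq (RelEdge H x)] (e : RelEdge H x) (q : ℚ) :
    toL2 (Finsupp.single e q) = lp.single 2 e (q : ℂ) := by
  ext e'
  by_cases h : e = e'
  · subst h; simp
  · simp [Finsupp.single_eq_of_ne (Ne.symm h), Pi.single_eq_of_ne (Ne.symm h)]

theorem single_eq_smul_toL2 [DecidableEq (RelEdge H x)] (e : RelEdge H x) (z : ℂ) :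
    (lp.single 2 e z : L2Chain H x) = z • toL2 (Finsupp.single e 1) := by
  rw [toL2_single, ← lp.single_smul]; simp

theorem star_toL2 (c : RelChain H x) : star (toL2 c) = toL2 c := by
  ext e
  change (starRingEnd ℂ) ((c e : ℚ) : ℂ) = _
  simp

theorem chainInner_eq (c d : RelChain H x) : (chainInner c d : ℂ) = inner ℂ (toL2 c) (toL2 d) := by
  rw [lp.inner_eq_tsum, tsum_eq_sum (s := c.support)]
  · simp [chainInner, mul_comm]
  · intro e he
    simp [Finsupp.notMem_support_iff.1 he]

theorem chainInner_eq_re (c d : RelChain H x) :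
    chainInner c d = (inner ℂ (toL2 c) (toL2 d)).re := by
  rw [← chainInner_eq, Complex.ofReal_re]

theorem chainNorm_eq (c : RelChain H x) : chainNorm c = ‖toL2 c‖ := by
  rw [chainNorm, chainInner_eq_re, norm_eq_sqrt_re_inner (𝕜 := ℂ)]; rfl

theorem norm_toL2_translate (g : PathClass x x) (c : RelChain H x) :
    ‖toL2 (RelChain.translate g c)‖ = ‖toL2 c‖ := by
  rw [← chainNorm_eq, ← chainNorm_eq, chainNorm, chainNorm]
  congr 1
  have hg := relEdge_translate_injective (H := H) g
  classical
  rw [chainInner, chainInner, RelChain.translate, Finsupp.lmapDomain_apply,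
    Finsupp.mapDomain_support_of_injective hg, Finset.sum_image fun _ _ _ _ h => hg h]
  simp [Finsupp.mapDomain_apply hg]

/-- Real square-summable chains are limits of rational chains. -/
theorem mem_closure_range_toL2 {y : L2Chain H x} (hy : IsRealFamily y) :
    y ∈ closure (Set.range (toL2 (H := H) (x := x))) := by
  classical
  -- Rational chains are not stable under complex scalars, so only their additive group is closed
  -- up.
  let K : AddSubgroup (L2Chain H x) :=
    { carrier := Set.range toL2
      add_mem' := by rintro _ _ ⟨c, rfl⟩ ⟨d, rfl⟩; exact ⟨c + d, toL2_add c d⟩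
      zero_mem' := ⟨0, toL2_zero⟩
      neg_mem' := by rintro _ ⟨c, rfl⟩; exact ⟨-c, by ext e; simp⟩ }
  change y ∈ K.topologicalClosure
  have hsum := lp.hasSum_single (p := 2) (by norm_num) y
  refine K.isClosed_topologicalClosure.mem_of_tendsto hsum (Filter.Eventually.of_forall fun s => ?_)
  refine sum_mem fun e _ => ?_
  have hre : ((y e).re : ℂ) = y e := by
    have : star (y e) = y e := congrArg (fun z : L2Chain H x => z e) hy
    exact Complex.conj_eq_iff_re.1 this
  have hcont : Continuous fun r : ℝ => (lp.single 2 e (r : ℂ) : L2Chain H x) := by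
    have h1 : Continuous fun z : ℂ => z • (lp.single 2 e (1 : ℂ) : L2Chain H x) := by fun_prop
    refine (h1.comp Complex.continuous_ofReal).congr fun r => ?_
    simp [← lp.single_smul]
  have := map_mem_closure hcont (Rat.isDenseEmbedding_coe_real.dense (y e).re)
    (t := Set.range toL2) (by
      rintro _ ⟨q, rfl⟩
      exact ⟨Finsupp.single e q, by rw [toL2_single]; simp⟩)
  simp only [hre] at this
  exact this

theorem exists_toL2_near {y : L2Chain H x} (hy : IsRealFamily y) {ε : ℝ} (hε : 0 < ε) :
    ∃ c : RelChain H x, ‖toL2 c - y‖ < ε := by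
  obtain ⟨_, ⟨c, rfl⟩, hc⟩ := Metric.mem_closure_iff.1 (mem_closure_range_toL2 hy) ε hε
  exact ⟨c, by rwa [← dist_eq_norm, dist_comm]⟩

/-- A bounded operator that preserves the image of the rational chains is real. -/
theorem map_star_of_forall_toL2 {A : L2Chain H x →L[ℂ] L2Chain H x}
    {L : RelChain H x → RelChain H x} (hA : ∀ c, A (toL2 c) = toL2 (L c)) (y : L2Chain H x) :
    A (star y) = star (A y) := by
  classical
  let S : L2Chain H x →+ L2Chain H x := (A : L2Chain H x →+ L2Chain H x).comp
    (starAddEquiv : L2Chain H x ≃+ L2Chain H x)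
  let T : L2Chain H x →+ L2Chain H x :=
    AddMonoidHom.comp (starAddEquiv : L2Chain H x ≃+ L2Chain H x)
      (A : L2Chain H x →+ L2Chain H x)
  have hST : S = T := by
    refine lp_addMonoidHom_ext (A.continuous.comp continuous_star)
      (continuous_star.comp A.continuous) fun e z => ?_
    rw [single_eq_smul_toL2]
    change A (star (z • toL2 _)) = star (A (z • toL2 _))
    rw [star_smul, star_toL2, map_smul, map_smul, hA, star_smul, star_toL2]
  exact DFunLike.congr_fun hST y

theorem clm_ext_toL2 {A B : L2Chain H x →L[ℂ] L2Chain H x}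
    (h : ∀ c : RelChain H x, A (toL2 c) = B (toL2 c)) : A = B := by
  classical
  have hST : (A : L2Chain H x →+ L2Chain H x) = (B : L2Chain H x →+ L2Chain H x) := by
    refine lp_addMonoidHom_ext A.continuous B.continuous fun e z => ?_
    rw [single_eq_smul_toL2]
    change A (z • toL2 _) = B (z • toL2 _)
    rw [map_smul, map_smul, h]
  ext1 y
  exact DFunLike.congr_fun hST y

end RationalChains

/-! ### Equivariant operators are bounded -/

section Equivariant

variable {V : Type u} [Quiver.{v} V] {x : V} {H : Subgraph V}

variable (H) in
/-- The edges of the graph outside the subgraph. -/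
abbrev BaseEdge := {e : Σ a b : V, (a ⟶ b) // e.2.2 ∉ H.edges}

/-- The lifts of an edge of the graph, parametrized by the fundamental group by means of a choice
of paths from the base point. -/
def liftEdge (p : ∀ a : V, PathClass x a) (t : BaseEdge H) (g : PathClass x x) : RelEdge H x :=
  ⟨⟨t.1.1, t.1.2.1, t.1.2.2, g ≫ p t.1.1⟩, t.2⟩

variable (p : ∀ a : V, PathClass x a)

theorem liftEdge_injective (t : BaseEdge H) : Function.Injective (liftEdge p t) := by
  intro g h hgh
  simp only [liftEdge, Subtype.mk.injEq, CoverEdge.mk.injEq, heq_eq_eq, true_and] at hgh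
  exact (cancel_mono (p t.1.1)).1 hgh

theorem baseEdge_eq_of_liftEdge_eq {t t' : BaseEdge H} {g g' : PathClass x x}
    (h : liftEdge p t g = liftEdge p t' g') : t = t' := by
  obtain ⟨⟨a, b, e⟩, he⟩ := t
  obtain ⟨⟨a', b', e'⟩, he'⟩ := t'
  simp only [liftEdge, Subtype.mk.injEq, CoverEdge.mk.injEq] at h
  obtain ⟨rfl, rfl, h1, -⟩ := h
  obtain rfl := eq_of_heq h1
  rfl

theorem exists_eq_liftEdge (e : RelEdge H x) : ∃ t g, e = liftEdge p t g := by
  refine ⟨⟨⟨e.1.src, e.1.tgt, e.1.edge⟩, e.2⟩, e.1.path ≫ Groupoid.inv (p e.1.src), ?_⟩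
  rw [liftEdge]
  simp only [Category.assoc, Groupoid.inv_comp, Category.comp_id]

theorem liftEdge_eq_translate (t : BaseEdge H) (g : PathClass x x) :
    liftEdge p t g = RelEdge.translate g (liftEdge p t (𝟙 (pt x))) := by
  simp [liftEdge, RelEdge.translate, CoverEdge.translate]

/-- A map on edges that is equivariant with respect to an injective map of the fundamental group
extends to a bounded operator. -/
theorem exists_equivariant_clm [Finite (BaseEdge H)] {φ : PathClass x x → PathClass x x}
    (hφ : Function.Injective φ) (N : BaseEdge H → RelChain H x) :
    ∃ A : L2Chain H x →L[ℂ] L2Chain H x, ∀ t g,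
      A (toL2 (Finsupp.single (liftEdge p t g) 1)) = toL2 (RelChain.translate (φ g) (N t)) := by
  classical
  have := Fintype.ofFinite (BaseEdge H)
  -- A matrix unit: restrict to the orbit of `t`, identified with the group, and push forward along
  -- g ↦ φ(g)e. The operator sought is a finite combination of these, with the coefficients of `N
  -- t`.
  let B : BaseEdge H → RelEdge H x → L2Chain H x →L[ℂ] L2Chain H x := fun t e =>
    (ContinuousLinearMap.adjoint
      (lpComap (fun g => RelEdge.translate (φ g) e)
        ((relEdge_translate_right_injective e).comp hφ))).comp
      (lpComap (liftEdge p t) (liftEdge_injective p t))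
  refine ⟨∑ t, ∑ e ∈ (N t).support, ((N t e : ℚ) : ℂ) • B t e, fun t g => ?_⟩
  have hB : ∀ e, B t e (toL2 (Finsupp.single (liftEdge p t g) 1)) =
      toL2 (Finsupp.single (RelEdge.translate (φ g) e) 1) := fun e => by
    simp only [B, toL2_single, ContinuousLinearMap.comp_apply]
    rw [lpComap_single, adjoint_lpComap_single]
  have hB' : ∀ t' e, t' ≠ t → B t' e (toL2 (Finsupp.single (liftEdge p t g) 1)) = 0 :=
    fun t' e ht => by
      simp only [B, toL2_single, ContinuousLinearMap.comp_apply]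
      rw [lpComap_single_of_notMem, map_zero]
      exact fun k hk => ht (baseEdge_eq_of_liftEdge_eq p hk)
  simp only [sum_apply, smul_apply]
  rw [Finset.sum_eq_single t (fun t' _ ht => Finset.sum_eq_zero fun e _ => by
    rw [hB' t' e ht, smul_zero]) (fun h => absurd (Finset.mem_univ t) h)]
  simp only [hB]
  have hN : RelChain.translate (φ g) (N t) = ∑ e ∈ (N t).support,
      (N t e) • Finsupp.single (RelEdge.translate (φ g) e) (1 : ℚ) := by
    conv_lhs => rw [← Finsupp.sum_single (N t)]
    simp [Finsupp.sum, RelChain.translate]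
  have hsum : ∀ (s : Finset (RelEdge H x)) (F : RelEdge H x → RelChain H x),
      toL2 (∑ e ∈ s, F e) = ∑ e ∈ s, toL2 (F e) := fun s F =>
    map_sum ({ toFun := toL2, map_zero' := toL2_zero, map_add' := toL2_add } :
      RelChain H x →+ L2Chain H x) F s
  rw [hN, hsum]
  simp only [toL2_smul]

/-- A bounded operator that agrees on edges with a linear map of rational chains extends it. -/
theorem map_toL2_of_forall_single {A : L2Chain H x →L[ℂ] L2Chain H x}
    {L : RelChain H x →ₗ[ℚ] RelChain H x}
    (h : ∀ e, A (toL2 (Finsupp.single e 1)) = toL2 (L (Finsupp.single e 1))) (c : RelChain H x) :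
    A (toL2 c) = toL2 (L c) := by
  induction c using Finsupp.induction_linear with
  | zero => simp
  | add c d hc hd => simp only [toL2_add, map_add, hc, hd]
  | single e q =>
    have : Finsupp.single e q = q • Finsupp.single e (1 : ℚ) := by simp
    rw [this, toL2_smul, map_smul, map_smul, h, toL2_smul]

/-- By twisted equivariance, `relMap` is determined by its values on one lift of each of the
finitely many base edges. Uniqueness holds because finite rational chains span a dense complex
subspace. -/
theorem existsUnique_isL2Extension [Finite (BaseEdge H)]
    (hconn : ∀ a : V, Nonempty (PathClass x a)) {f : GraphMap V} (hf : f.IsHomotopyEquiv)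
    (hx : f.obj x = x) : ∃! A : L2Chain H x →L[ℂ] L2Chain H x, IsL2Extension f hx A := by
  let p : ∀ a : V, PathClass x a := fun a => (hconn a).some
  obtain ⟨A, hA⟩ := exists_equivariant_clm p (groupMap_bijective f hx hf).1
    fun t : BaseEdge H => relMap H f hx (Finsupp.single (liftEdge p t (𝟙 (pt x))) 1)
  refine ⟨A, map_toL2_of_forall_single fun e => ?_, fun B hB => clm_ext_toL2 fun c => ?_⟩
  · obtain ⟨t, g, rfl⟩ := exists_eq_liftEdge p e
    rw [hA, ← relMap_translate, liftEdge_eq_translate p t g]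
    simp [RelChain.translate]
  · rw [hB c]
    symm
    refine map_toL2_of_forall_single (fun e => ?_) c
    obtain ⟨t, g, rfl⟩ := exists_eq_liftEdge p e
    rw [hA, ← relMap_translate, liftEdge_eq_translate p t g]
    simp [RelChain.translate]

/-- A decomposition of the rational chains into two submodules extends to square-summable chains
with bounded, though not necessarily orthogonal, projections. -/
theorem exists_clm_of_sup_eq_top [Finite (BaseEdge H)]
    (hconn : ∀ a : V, Nonempty (PathClass x a)) {W W' : Submodule ℚ (RelChain H x)}
    (hW : IsGroupInvariant W) (hW' : IsGroupInvariant W') (h : W ⊔ W' = ⊤) :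
    ∃ (P : L2Chain H x →L[ℂ] L2Chain H x) (L : RelChain H x →ₗ[ℚ] RelChain H x),
      (∀ c, P (toL2 c) = toL2 (L c)) ∧ (∀ c, L c ∈ W) ∧ ∀ c, c - L c ∈ W' := by
  let p : ∀ a : V, PathClass x a := fun a => (hconn a).some
  -- Only one representative of each orbit is decomposed. Translating these choices keeps the
  -- operator bounded, and invariance of `W` and `W'` keeps the components in place.
  have hdec : ∀ t : BaseEdge H, ∃ c ∈ W,
      Finsupp.single (liftEdge p t (𝟙 (pt x))) (1 : ℚ) - c ∈ W' := fun t => by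
    have ht : Finsupp.single (liftEdge p t (𝟙 (pt x))) (1 : ℚ) ∈ W ⊔ W' := h ▸ Submodule.mem_top
    obtain ⟨c, hc, d, hd, hcd⟩ := Submodule.mem_sup.1 ht
    exact ⟨c, hc, by rwa [← hcd, add_sub_cancel_left]⟩
  choose N hN hN' using hdec
  obtain ⟨P, hP⟩ := exists_equivariant_clm p Function.injective_id N
  choose t g htg using exists_eq_liftEdge (H := H) p
  let L : RelChain H x →ₗ[ℚ] RelChain H x :=
    Finsupp.linearCombination ℚ fun e => RelChain.translate (g e) (N (t e))
  have hL : ∀ e, L (Finsupp.single e 1) = RelChain.translate (g e) (N (t e)) := fun e => by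
    simp [L]
  refine ⟨P, L, map_toL2_of_forall_single fun e => ?_, fun c => ?_, fun c => ?_⟩
  · rw [hL, ← id_def (g e), ← hP, ← htg]
  · induction c using Finsupp.induction_linear with
    | zero => simp
    | add c d hc hd => rw [map_add]; exact add_mem hc hd
    | single e q =>
      have : Finsupp.single e q = q • Finsupp.single e (1 : ℚ) := by simp
      rw [this, map_smul, hL]
      exact W.smul_mem _ (hW _ _ (hN _))
  · induction c using Finsupp.induction_linear with
    | zero => simp
    | add c d hc hd => rw [map_add, add_sub_add_comm]; exact add_mem hc hd
    | single e q =>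
      have : Finsupp.single e q = q • Finsupp.single e (1 : ℚ) := by simp
      rw [this, map_smul, hL, ← smul_sub]
      refine W'.smul_mem _ ?_
      have h1 := hW' (g e) _ (hN' (t e))
      rw [map_sub] at h1
      convert h1 using 2
      rw [RelChain.translate, Finsupp.lmapDomain_apply, Finsupp.mapDomain_single,
        ← liftEdge_eq_translate, ← htg]

end Equivariant

/-! ### Growth of orbits -/

section Growth

open Filter Topology

variable {E : Type*} [NormedAddCommGroup E]

theorem tendsto_norm_div_pow_of_limsup_le {r : ℕ → E} {ν lam : ℝ} (hν : 0 < ν) (hlam : ν < lam)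
    (h : limsup (fun j : ℕ => ‖r j‖ₑ ^ (1 / (j : ℝ))) atTop ≤ ENNReal.ofReal ν) :
    Tendsto (fun j => ‖r j‖ / lam ^ j) atTop (𝓝 0) := by
  -- Eventually the norms are at most μʲ, and (μ/lam)ʲ tends to 0.
  obtain ⟨μ, h1, h2⟩ := exists_between hlam
  have hμ : 0 < μ := hν.trans h1
  have hl : 0 < lam := hν.trans hlam
  have hev : ∀ᶠ j : ℕ in atTop, ‖r j‖ₑ ^ (1 / (j : ℝ)) < ENNReal.ofReal μ :=
    eventually_lt_of_limsup_lt (h.trans_lt ((ENNReal.ofReal_lt_ofReal_iff hμ).2 h1))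
  refine squeeze_zero' (Eventually.of_forall fun j => by positivity) ?_
    (tendsto_pow_atTop_nhds_zero_of_lt_one (r := μ / lam) (by positivity)
      ((div_lt_one hl).2 h2))
  filter_upwards [hev, eventually_ge_atTop 1] with j hj hj1
  have hj0 : (0 : ℝ) < j := by exact_mod_cast hj1
  have h3 : ‖r j‖ₑ ≤ ENNReal.ofReal (μ ^ j) := by
    have := ENNReal.rpow_le_rpow hj.le hj0.le
    rw [← ENNReal.rpow_mul, one_div_mul_cancel hj0.ne', ENNReal.rpow_one, ENNReal.rpow_natCast,
      ← ENNReal.ofReal_pow hμ.le] at this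
    exact this
  rw [← ofReal_norm, ENNReal.ofReal_le_ofReal_iff (by positivity)] at h3
  rw [div_pow]
  gcongr

/-- The bound j eventually exceeds any constant and is still subexponential, as j^(1/j) tends to 1.
-/
theorem limsup_enorm_rpow_le {r : ℕ → E} {ν : ℝ} (hν : 1 ≤ ν) (h : ∀ j : ℕ, ‖r j‖ ≤ j) :
    limsup (fun j : ℕ => ‖r j‖ₑ ^ (1 / (j : ℝ))) atTop ≤ ENNReal.ofReal ν := by
  have ht : Tendsto (fun j : ℕ => ENNReal.ofReal ((j : ℝ) ^ (1 / (j : ℝ)))) atTop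
      (𝓝 (ENNReal.ofReal 1)) :=
    ENNReal.tendsto_ofReal (tendsto_rpow_div.comp tendsto_natCast_atTop_atTop)
  refine (limsup_le_limsup (Eventually.of_forall fun j => ?_)).trans
    (ht.limsup_eq.le.trans (ENNReal.ofReal_le_ofReal hν))
  rw [← ofReal_norm, ENNReal.ofReal_rpow_of_nonneg (norm_nonneg _) (by positivity)]
  exact ENNReal.ofReal_le_ofReal (Real.rpow_le_rpow (norm_nonneg _) (h j) (by positivity))

/-- A diagonal argument: points that are approximated by points which lie in almost all of the sets
`S j` are limits of sequences through the sets `S j`. -/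
theorem exists_seq_mem_tendsto {S : ℕ → Set E} (h0 : ∀ j, (S j).Nonempty) {ξ : E}
    (h : ξ ∈ closure {y | ∀ᶠ j in atTop, y ∈ S j}) :
    ∃ s : ℕ → E, (∀ j, s j ∈ S j) ∧ Tendsto s atTop (𝓝 ξ) := by
  -- Take an almost nearest point of `S j`; the distances tend to 0 because each approximating point
  -- eventually lies in `S j`.
  have hex : ∀ j : ℕ, ∃ y ∈ S j, dist ξ y < Metric.infDist ξ (S j) + 1 / ((j : ℝ) + 1) := fun j =>
    (Metric.infDist_lt_iff (h0 j)).1 (by linarith [Nat.one_div_pos_of_nat (α := ℝ) (n := j)])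
  choose s hs hd using hex
  refine ⟨s, hs, ?_⟩
  rw [Metric.tendsto_atTop']
  intro ε hε
  obtain ⟨y, hy, hyd⟩ := Metric.mem_closure_iff.1 h (ε / 2) (half_pos hε)
  have hsmall : ∀ᶠ j : ℕ in atTop, 1 / ((j : ℝ) + 1) < ε / 2 :=
    tendsto_one_div_add_atTop_nhds_zero_nat.eventually (gt_mem_nhds (half_pos hε))
  obtain ⟨n, hn⟩ := eventually_atTop.1 (hy.and hsmall)
  refine ⟨n, fun j hj => ?_⟩
  obtain ⟨h1, h2⟩ := hn j hj.le
  have h3 := Metric.infDist_le_dist_of_mem (x := ξ) h1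
  rw [dist_comm]
  linarith [hd j]

end Growth

/-! ### Bounded and slow orbits. -/

section Orbits

open Filter Topology

variable {E : Type*} [NormedAddCommGroup E] [InnerProductSpace ℂ E] (A : E →L[ℂ] E)

/-- `ξ` is the limit of points whose forward orbits grow slower than `lam ^ j`. -/
def IsSlowForward (lam : ℝ) (ξ : E) : Prop :=
  ∃ s : ℕ → E, Tendsto s atTop (𝓝 ξ) ∧
    Tendsto (fun j => ‖(A ^ j) (s j)‖ / lam ^ j) atTop (𝓝 0)

/-- `ξ` is the limit of points with backward orbits that grow slower than `lam ^ j`. -/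
def IsSlowBackward (lam : ℝ) (ξ : E) : Prop :=
  ∃ s : ℕ → E, Tendsto (fun j => (A ^ j) (s j)) atTop (𝓝 ξ) ∧
    Tendsto (fun j => ‖s j‖ / lam ^ j) atTop (𝓝 0)

/-- The vectors with bounded forward orbit. -/
def boundedForward : Submodule ℂ E where
  carrier := {y | ∃ C : ℝ, ∀ j : ℕ, ‖(A ^ j) y‖ ≤ C}
  add_mem' := by
    rintro y z ⟨C, hC⟩ ⟨D, hD⟩
    exact ⟨C + D, fun j => by rw [map_add]; exact norm_add_le_of_le (hC j) (hD j)⟩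
  zero_mem' := ⟨0, fun j => by simp⟩
  smul_mem' := by
    rintro a y ⟨C, hC⟩
    exact ⟨‖a‖ * C, fun j => by
      rw [map_smul, norm_smul]; exact mul_le_mul_of_nonneg_left (hC j) (norm_nonneg a)⟩

/-- The vectors with bounded preimages under all powers. -/
def boundedBackward : Submodule ℂ E where
  carrier := {y | ∃ C : ℝ, ∀ j : ℕ, ∃ t, (A ^ j) t = y ∧ ‖t‖ ≤ C}
  add_mem' := by
    rintro y z ⟨C, hC⟩ ⟨D, hD⟩
    refine ⟨C + D, fun j => ?_⟩
    obtain ⟨t, ht, ht'⟩ := hC j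
    obtain ⟨w, hw, hw'⟩ := hD j
    exact ⟨t + w, by rw [map_add, ht, hw], norm_add_le_of_le ht' hw'⟩
  zero_mem' := ⟨0, fun j => ⟨0, by simp, by simp⟩⟩
  smul_mem' := by
    rintro a y ⟨C, hC⟩
    refine ⟨‖a‖ * C, fun j => ?_⟩
    obtain ⟨t, ht, ht'⟩ := hC j
    exact ⟨a • t, by rw [map_smul, ht], by
      rw [norm_smul]; exact mul_le_mul_of_nonneg_left ht' (norm_nonneg a)⟩

variable {A}

/-- Approximants of a limit need not share a bound, so the diagonal argument is run with the bound j
on the j-th image. -/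
theorem closure_boundedForward_subset {ν : ℝ} (hν : 1 ≤ ν) :
    closure (boundedForward A : Set E) ⊆ subspaceE A ν := by
  intro ξ hξ
  obtain ⟨s, hs, ht⟩ := exists_seq_mem_tendsto (S := fun j : ℕ => {y | ‖(A ^ j) y‖ ≤ j})
    (fun j => ⟨0, by simp⟩) (ξ := ξ) (closure_mono (fun y hy => by
      obtain ⟨C, hC⟩ := hy
      filter_upwards [tendsto_natCast_atTop_atTop.eventually_ge_atTop C] with j hj
      exact (hC j).trans hj) hξ)
  exact ⟨s, ht, limsup_enorm_rpow_le hν hs⟩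

theorem closure_boundedBackward_subset {ν : ℝ} (hν : 1 ≤ ν) :
    closure (boundedBackward A : Set E) ⊆ subspaceF A ν⁻¹ := by
  intro ξ hξ
  obtain ⟨s, hs, ht⟩ := exists_seq_mem_tendsto
    (S := fun j : ℕ => {y | ∃ t, (A ^ j) t = y ∧ ‖t‖ ≤ j})
    (fun j => ⟨0, 0, by simp⟩) (ξ := ξ) (closure_mono (fun y hy => by
      obtain ⟨C, hC⟩ := hy
      filter_upwards [tendsto_natCast_atTop_atTop.eventually_ge_atTop C] with j hj
      obtain ⟨t, h1, h2⟩ := hC j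
      exact ⟨t, h1, h2.trans hj⟩) hξ)
  choose t h1 h2 using hs
  refine ⟨t, by simpa only [h1] using ht, ?_⟩
  rw [inv_inv]
  exact limsup_enorm_rpow_le hν h2

theorem isSlowForward_of_mem_subspaceE {ν lam : ℝ} (hν : 0 < ν) (hlam : ν < lam) {ξ : E}
    (h : ξ ∈ subspaceE A ν) : IsSlowForward A lam ξ := by
  obtain ⟨s, hs, hl⟩ := h
  exact ⟨s, hs, tendsto_norm_div_pow_of_limsup_le hν hlam hl⟩

theorem isSlowBackward_of_mem_subspaceF {ν lam : ℝ} (hν : 0 < ν) (hlam : ν < lam) {ξ : E}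
    (h : ξ ∈ subspaceF A ν⁻¹) : IsSlowBackward A lam ξ := by
  obtain ⟨s, hs, hl⟩ := h
  rw [inv_inv] at hl
  exact ⟨s, hs, tendsto_norm_div_pow_of_limsup_le hν hlam hl⟩

theorem IsSlowForward.sub {lam : ℝ} (hlam : 0 < lam) {ξ ζ : E} (hξ : IsSlowForward A lam ξ)
    (hζ : IsSlowForward A lam ζ) : IsSlowForward A lam (ξ - ζ) := by
  obtain ⟨s, hs, hs'⟩ := hξ
  obtain ⟨t, ht, ht'⟩ := hζ
  have hsum := hs'.add ht'
  rw [add_zero] at hsum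
  refine ⟨fun j => s j - t j, hs.sub ht,
    squeeze_zero (fun j => by positivity) (fun j => ?_) hsum⟩
  rw [map_sub, ← add_div]
  gcongr
  exact norm_sub_le _ _

theorem IsSlowBackward.sub {lam : ℝ} (hlam : 0 < lam) {ξ ζ : E} (hξ : IsSlowBackward A lam ξ)
    (hζ : IsSlowBackward A lam ζ) : IsSlowBackward A lam (ξ - ζ) := by
  obtain ⟨s, hs, hs'⟩ := hξ
  obtain ⟨t, ht, ht'⟩ := hζ
  have hsum := hs'.add ht'
  rw [add_zero] at hsum
  refine ⟨fun j => s j - t j, by simpa only [map_sub] using hs.sub ht,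
    squeeze_zero (fun j => by positivity) (fun j => ?_) hsum⟩
  rw [← add_div]
  gcongr
  exact norm_sub_le _ _

theorem IsSlowForward.smul {lam : ℝ} {ξ : E} (hξ : IsSlowForward A lam ξ) (a : ℂ) :
    IsSlowForward A lam (a • ξ) := by
  obtain ⟨s, hs, hs'⟩ := hξ
  refine ⟨fun j => a • s j, hs.const_smul a, ?_⟩
  simpa only [map_smul, norm_smul, mul_div_assoc, mul_zero] using hs'.const_mul ‖a‖

theorem IsSlowBackward.smul {lam : ℝ} {ξ : E} (hξ : IsSlowBackward A lam ξ) (a : ℂ) :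
    IsSlowBackward A lam (a • ξ) := by
  obtain ⟨s, hs, hs'⟩ := hξ
  refine ⟨fun j => a • s j, by simpa only [map_smul] using hs.const_smul a, ?_⟩
  simpa only [norm_smul, mul_div_assoc, mul_zero] using hs'.const_mul ‖a‖

end Orbits

/-! ### Sequences satisfying the flare inequality -/

section FlareSequences

variable {lam : ℝ} {a : ℕ → ℝ}

/-- A flaring sequence that does not contract in the first step grows exponentially. -/
theorem pow_mul_le_of_flare (hlam : 1 < lam) (h0 : ∀ k, 0 ≤ a k)
    (h : ∀ k, lam * a (k + 1) ≤ max (a (k + 2)) (a k)) (h1 : a 0 < lam * a 1) (k : ℕ) :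
    lam ^ k * a 1 ≤ a (k + 1) := by
  have hl : 0 < lam := by linarith
  have h1pos : 0 < a 1 := by
    by_contra hn
    have : a 1 = 0 := le_antisymm (not_lt.1 hn) (h0 1)
    rw [this, mul_zero] at h1
    exact absurd (h0 0) (not_le.2 h1)
  -- The second inequality rules out `a k` in the maximum, and the resulting expansion restores it
  -- for the next k.
  have key : ∀ k, 0 < a (k + 1) ∧ a k < lam * a (k + 1) := by
    intro k
    induction k with
    | zero => exact ⟨h1pos, h1⟩
    | succ k ih =>
      have h2 : lam * a (k + 1) ≤ a (k + 2) :=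
        (le_max_iff.1 (h k)).resolve_right (not_le.2 ih.2)
      have h3 : 0 < a (k + 2) := (mul_pos hl ih.1).trans_le h2
      refine ⟨h3, ?_⟩
      have : a (k + 1) < lam * a (k + 1) := by nlinarith [ih.1]
      nlinarith
  induction k with
  | zero => simp
  | succ k ih =>
    have h2 : lam * a (k + 1) ≤ a (k + 2) :=
      (le_max_iff.1 (h k)).resolve_right (not_le.2 (key k).2)
    calc lam ^ (k + 1) * a 1 = lam * (lam ^ k * a 1) := by ring
      _ ≤ lam * a (k + 1) := by gcongr
      _ ≤ _ := h2

/-- A flaring sequence that does not expand in the last step decays exponentially. -/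
theorem pow_mul_le_of_flare_of_lt (hlam : 1 < lam) {j : ℕ} (hj : 0 < a j)
    (h : ∀ k < j, lam * a (k + 1) ≤ max (a (k + 2)) (a k)) (h1 : a (j + 1) < lam * a j) :
    lam ^ j * a j ≤ a 0 := by
  -- The mirror image, descending from j: failure to expand rules out the later term of the maximum.
  have key : ∀ k ≤ j, lam ^ k * a j ≤ a (j - k) ∧ 0 < a (j - k) ∧
      a (j - k + 1) < lam * a (j - k) := by
    intro k
    induction k with
    | zero => intro _; simpa using ⟨hj, h1⟩
    | succ k ih =>
      intro hk
      obtain ⟨i, hi⟩ : ∃ i, j = i + (k + 1) := ⟨j - (k + 1), by omega⟩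
      obtain ⟨ih1, ih2, ih3⟩ := ih (by omega)
      have e1 : j - k = i + 1 := by omega
      have e2 : j - (k + 1) = i := by omega
      rw [e1] at ih1 ih2 ih3
      rw [e2]
      have h2 : lam * a (i + 1) ≤ a i :=
        (le_max_iff.1 (h i (by omega))).resolve_left (not_le.2 ih3)
      have h3 : a (i + 1) < lam * a (i + 1) := by nlinarith
      refine ⟨?_, by linarith, by nlinarith⟩
      calc lam ^ (k + 1) * a j = lam * (lam ^ k * a j) := by ring
        _ ≤ lam * a (i + 1) := by gcongr
        _ ≤ _ := h2
  simpa using (key j le_rfl).1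

end FlareSequences

/-! ### The main theorem -/

section Main

open Filter Topology

variable {V : Type u} [Quiver.{v} V] {x : V} {H : Subgraph V} {f : GraphMap V} {hx : f.obj x = x}
  {A : L2Chain H x →L[ℂ] L2Chain H x}

theorem IsL2Extension.pow_apply (hA : IsL2Extension f hx A) (j : ℕ) (c : RelChain H x) :
    (A ^ j) (toL2 c) = toL2 ((relMap H f hx)^[j] c) := by
  induction j generalizing c with
  | zero => rfl
  | succ j ih => rw [pow_succ, mul_apply_eq_comp, hA, ih]; rfl

theorem IsL2Extension.norm_pow_apply (hA : IsL2Extension f hx A) (j : ℕ) (c : RelChain H x) :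
    ‖(A ^ j) (toL2 c)‖ = chainNorm ((relMap H f hx)^[j] c) := by
  rw [hA.pow_apply, chainNorm_eq]

/-- Rational chains close to a nonzero limit of elements of `W` make a small angle with `W`. -/
theorem eventually_mem_angleNhd {θ : ℝ} (hθ : θ < 1) {W : Submodule ℚ (RelChain H x)}
    {η : L2Chain H x} (hη : η ≠ 0) (hW : η ∈ closure (toL2 '' (W : Set (RelChain H x)))) :
    ∀ᶠ y in 𝓝 η, ∀ d : RelChain H x, toL2 d = y → d ∈ angleNhd θ W := by
  have hcont : Continuous fun z : L2Chain H x × L2Chain H x =>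
      (inner ℂ z.1 z.2).re - θ * ‖z.1‖ * ‖z.2‖ := by fun_prop
  -- The angle condition is open in both arguments and holds at (η, η), with margin (1 - θ)‖η‖².
  have hpos : 0 < (inner ℂ η η).re - θ * ‖η‖ * ‖η‖ := by
    have h1 : (inner ℂ η η).re = ‖η‖ * ‖η‖ := by
      rw [inner_self_eq_norm_mul_norm (𝕜 := ℂ) η |>.symm]; rfl
    have h2 : 0 < ‖η‖ := norm_pos_iff.2 hη
    rw [h1]
    nlinarith [mul_pos h2 h2]
  have hev := (hcont.tendsto (η, η)).eventually (lt_mem_nhds hpos)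
  rw [nhds_prod_eq] at hev
  obtain ⟨p, hp, q, hq, hpq⟩ := eventually_prod_iff.1 hev
  obtain ⟨_, hc, c, hcW, rfl⟩ := mem_closure_iff_nhds.1 hW _ hp
  filter_upwards [hq] with y hy d hd
  subst hd
  refine ⟨c, hcW, ?_⟩
  have := hpq hc hy
  rw [chainInner_eq_re, chainNorm_eq, chainNorm_eq]
  simp only at this
  linarith

variable {Vh : Submodule ℚ (RelChain H x)} {lam θ : ℝ}

/-- If a rational approximant failed to contract in the first step, flaring would make its j-th
image of order at least lamʲ, against slowness. The inequality then passes to the limit. -/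
theorem norm_contract_of_isSlowForward (hA : IsL2Extension f hx A) (hlam : 1 < lam) (hθ : θ < 1)
    (hflare : ∀ c ∈ orbitSet (relMap H f hx) (angleNhd θ Vh),
      lam * chainNorm (relMap H f hx c) ≤
        max (chainNorm (relMap H f hx (relMap H f hx c))) (chainNorm c))
    {η : L2Chain H x} (hη : η ≠ 0) (hreal : IsRealFamily η)
    (hW : η ∈ closure (toL2 '' (Vh : Set (RelChain H x)))) (hs : IsSlowForward A lam η) :
    lam * ‖A η‖ ≤ ‖η‖ := by
  obtain ⟨s, hs, hgrow⟩ := hs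
  have hl : 0 < lam := by linarith
  have hAre := map_star_of_forall_toL2 hA
  have hre : lpRe η = η := by
    have : star η = η := hreal
    rw [lpRe, this, ← two_smul ℂ η, smul_smul]; norm_num
  -- The tolerance makes the error tend to 0 while its image under Aʲ stays at most 1.
  have hex : ∀ j : ℕ, ∃ c : RelChain H x, ‖toL2 c - lpRe (s j)‖ <
      1 / (((j : ℝ) + 1) * (1 + ‖A ^ j‖)) := fun j =>
    exists_toL2_near (isRealFamily_lpRe _) (by positivity)
  choose c hc using hex
  have hc1 : ∀ j, ‖toL2 (c j) - lpRe (s j)‖ ≤ 1 / ((j : ℝ) + 1) := fun j =>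
    (hc j).le.trans (one_div_le_one_div_of_le (by positivity)
      (le_mul_of_one_le_right (by positivity) (by linarith [norm_nonneg (A ^ j)])))
  have hc2 : ∀ j, ‖(A ^ j) (toL2 (c j))‖ ≤ ‖(A ^ j) (s j)‖ + 1 := fun j => by
    have h1 : ‖(A ^ j) (toL2 (c j) - lpRe (s j))‖ ≤ 1 := by
      refine ((A ^ j).le_opNorm _).trans ((mul_le_mul_of_nonneg_left (hc j).le
        (norm_nonneg _)).trans ?_)
      rw [mul_one_div, div_le_one (by positivity)]
      nlinarith [norm_nonneg (A ^ j), Nat.cast_nonneg (α := ℝ) j]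
    have h2 : ‖(A ^ j) (lpRe (s j))‖ ≤ ‖(A ^ j) (s j)‖ := by
      rw [pow_lpRe hAre]; exact norm_lpRe_le _
    have h3 : (A ^ j) (toL2 (c j)) =
        (A ^ j) (lpRe (s j)) + (A ^ j) (toL2 (c j) - lpRe (s j)) := by
      rw [← map_add]; simp
    rw [h3]
    exact norm_add_le_of_le h2 h1
  have hlim : Tendsto (fun j => toL2 (c j)) atTop (𝓝 η) := by
    have h1 : Tendsto (fun j => toL2 (c j) - lpRe (s j)) atTop (𝓝 0) :=
      squeeze_zero_norm hc1 tendsto_one_div_add_atTop_nhds_zero_nat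
    have h2 := h1.add ((continuous_lpRe.tendsto η).comp hs)
    simpa [hre] using h2
  -- One factor `lam` comes from the non-contracting first step, the other from growth starting only
  -- at the first image.
  have hdecay : Tendsto (fun j => lam * lam * ((‖(A ^ j) (s j)‖ + 1) / lam ^ j)) atTop (𝓝 0) := by
    have h1 : Tendsto (fun j : ℕ => 1 / lam ^ j) atTop (𝓝 0) := by
      simpa [Function.comp_def] using tendsto_inv_atTop_zero.comp (tendsto_pow_atTop_atTop_of_one_lt hlam)
    simpa [add_div] using (hgrow.add h1).const_mul (lam * lam)
  have hsmall := hdecay.eventually_lt hlim.norm (norm_pos_iff.2 hη)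
  refine le_of_tendsto_of_tendsto (((A.continuous.tendsto η).comp hlim).norm.const_mul lam)
    hlim.norm ?_
  filter_upwards [hlim.eventually (eventually_mem_angleNhd hθ hη hW), hsmall,
    eventually_ge_atTop 1] with j hj1 hj2 hj3
  by_contra hcon
  obtain ⟨i, rfl⟩ : ∃ i, j = i + 1 := ⟨j - 1, by omega⟩
  set a : ℕ → ℝ := fun k => chainNorm ((relMap H f hx)^[k] (c (i + 1))) with ha
  have ha' : ∀ k, a k = ‖(A ^ k) (toL2 (c (i + 1)))‖ := fun k => (hA.norm_pow_apply k _).symm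
  have hfl : ∀ k, lam * a (k + 1) ≤ max (a (k + 2)) (a k) := fun k => by
    simp only [ha, Function.iterate_succ_apply']
    exact hflare _ (Set.mem_iUnion.2 ⟨k, Or.inl ⟨_, hj1 _ rfl, rfl⟩⟩)
  have hlt : a 0 < lam * a 1 := by
    rw [ha', ha']; simpa using hcon
  have hgr := pow_mul_le_of_flare hlam (fun k => by rw [ha']; positivity) hfl hlt i
  have h4 : a (i + 1) ≤ ‖(A ^ (i + 1)) (s (i + 1))‖ + 1 := by rw [ha']; exact hc2 _
  have h5 : a 0 = ‖toL2 (c (i + 1))‖ := by rw [ha']; simp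
  rw [← h5, mul_div_assoc', div_lt_iff₀ (by positivity), pow_succ] at hj2
  have h6 : lam * lam * (lam ^ i * a 1) < a 0 * (lam ^ i * lam) :=
    (mul_le_mul_of_nonneg_left (hgr.trans h4) (by positivity)).trans_lt hj2
  have h7 : (lam ^ i * lam) * (lam * a 1) < (lam ^ i * lam) * a 0 := by linarith
  exact absurd (lt_of_mul_lt_mul_left h7 (by positivity)) (not_lt.2 hlt.le)

/-- Here the j-th image of the approximant is near η. If the next step failed to expand, flaring
read backwards would make the approximant itself at least lamʲ times as long as that image. -/
theorem norm_expand_of_isSlowBackward (hA : IsL2Extension f hx A) (hlam : 1 < lam) (hθ : θ < 1)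
    (hflare : ∀ c ∈ orbitSet (relMap H f hx) (angleNhd θ Vh),
      lam * chainNorm (relMap H f hx c) ≤
        max (chainNorm (relMap H f hx (relMap H f hx c))) (chainNorm c))
    {η : L2Chain H x} (hη : η ≠ 0) (hreal : IsRealFamily η)
    (hW : η ∈ closure (toL2 '' (Vh : Set (RelChain H x)))) (hs : IsSlowBackward A lam η) :
    lam * ‖η‖ ≤ ‖A η‖ := by
  obtain ⟨s, hs, hgrow⟩ := hs
  have hl : 0 < lam := by linarith
  have hAre := map_star_of_forall_toL2 hA
  have hre : lpRe η = η := by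
    have : star η = η := hreal
    rw [lpRe, this, ← two_smul ℂ η, smul_smul]; norm_num
  have hex : ∀ j : ℕ, ∃ c : RelChain H x, ‖toL2 c - lpRe (s j)‖ <
      1 / (((j : ℝ) + 1) * (1 + ‖A ^ j‖)) := fun j =>
    exists_toL2_near (isRealFamily_lpRe _) (by positivity)
  choose c hc using hex
  have hc1 : ∀ j, ‖toL2 (c j)‖ ≤ ‖s j‖ + 1 := fun j => by
    have h1 : ‖toL2 (c j) - lpRe (s j)‖ ≤ 1 := by
      refine (hc j).le.trans ?_
      rw [div_le_one (by positivity)]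
      nlinarith [norm_nonneg (A ^ j), Nat.cast_nonneg (α := ℝ) j]
    have h3 : toL2 (c j) = lpRe (s j) + (toL2 (c j) - lpRe (s j)) := by simp
    rw [h3]
    exact norm_add_le_of_le (norm_lpRe_le _) h1
  have hc2 : ∀ j, ‖(A ^ j) (toL2 (c j)) - lpRe ((A ^ j) (s j))‖ ≤ 1 / ((j : ℝ) + 1) := fun j => by
    rw [← pow_lpRe hAre, ← map_sub]
    refine ((A ^ j).le_opNorm _).trans ((mul_le_mul_of_nonneg_left (hc j).le
      (norm_nonneg _)).trans ?_)
    rw [mul_one_div, div_le_div_iff₀ (by positivity) (by positivity)]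
    nlinarith [norm_nonneg (A ^ j), Nat.cast_nonneg (α := ℝ) j]
  have hlim : Tendsto (fun j => (A ^ j) (toL2 (c j))) atTop (𝓝 η) := by
    have h1 : Tendsto (fun j => (A ^ j) (toL2 (c j)) - lpRe ((A ^ j) (s j))) atTop (𝓝 0) :=
      squeeze_zero_norm hc2 tendsto_one_div_add_atTop_nhds_zero_nat
    have h2 := h1.add ((continuous_lpRe.tendsto η).comp hs)
    simpa [hre] using h2
  have hdecay : Tendsto (fun j => (‖s j‖ + 1) / lam ^ j) atTop (𝓝 0) := by
    have h1 : Tendsto (fun j : ℕ => 1 / lam ^ j) atTop (𝓝 0) := by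
      simpa [Function.comp_def] using tendsto_inv_atTop_zero.comp (tendsto_pow_atTop_atTop_of_one_lt hlam)
    simpa [add_div] using hgrow.add h1
  have hsmall := hdecay.eventually_lt hlim.norm (norm_pos_iff.2 hη)
  refine le_of_tendsto_of_tendsto (hlim.norm.const_mul lam)
    ((A.continuous.tendsto η).comp hlim).norm ?_
  filter_upwards [hlim.eventually (eventually_mem_angleNhd hθ hη hW), hsmall,
    hlim.norm.eventually (lt_mem_nhds (norm_pos_iff.2 hη))] with j hj1 hj2 hj3
  by_contra hcon
  set a : ℕ → ℝ := fun k => chainNorm ((relMap H f hx)^[k] (c j)) with ha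
  have ha' : ∀ k, a k = ‖(A ^ k) (toL2 (c j))‖ := fun k => (hA.norm_pow_apply k _).symm
  have hfl : ∀ k < j, lam * a (k + 1) ≤ max (a (k + 2)) (a k) := fun k hk => by
    simp only [ha, Function.iterate_succ_apply']
    -- The k-th iterate reaches the cone after j - k more steps; this is what the preimages in
    -- `orbitSet` are for.
    refine hflare _ (Set.mem_iUnion.2 ⟨j - k, Or.inr (hj1 _ ?_)⟩)
    rw [← Function.iterate_add_apply, Nat.sub_add_cancel hk.le, hA.pow_apply]
  have hlt : a (j + 1) < lam * a j := by
    rw [ha', ha', pow_succ']; simpa using hcon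
  have hgr := pow_mul_le_of_flare_of_lt hlam (by rw [ha']; exact hj3) hfl hlt
  have h5 : a 0 ≤ ‖s j‖ + 1 := by rw [ha']; simpa using hc1 j
  rw [← ha', div_lt_iff₀ (by positivity)] at hj2
  linarith

/-- A slow real vector in the closure of the hyperbolic submodule vanishes. -/
theorem eq_zero_of_isSlow (hA : IsL2Extension f hx A) (hlam : 1 < lam) (hθ : θ < 1)
    (hflare : ∀ c ∈ orbitSet (relMap H f hx) (angleNhd θ Vh),
      lam * chainNorm (relMap H f hx c) ≤
        max (chainNorm (relMap H f hx (relMap H f hx c))) (chainNorm c))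
    {η : L2Chain H x} (hreal : IsRealFamily η)
    (hW : η ∈ closure (toL2 '' (Vh : Set (RelChain H x)))) (hs : IsSlowForward A lam η)
    (hs' : IsSlowBackward A lam η) : η = 0 := by
  by_contra hη
  have h1 := norm_contract_of_isSlowForward hA hlam hθ hflare hη hreal hW hs
  have h2 := norm_expand_of_isSlowBackward hA hlam hθ hflare hη hreal hW hs'
  have h3 : 0 < ‖η‖ := norm_pos_iff.2 hη
  have h4 : ‖η‖ < lam * ‖η‖ := by nlinarith
  have h5 : ‖A η‖ ≤ lam * ‖A η‖ := by nlinarith [norm_nonneg (A η)]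
  linarith

theorem IsSlowForward.lpRe (hA : ∀ y, A (star y) = star (A y)) {ξ : L2Chain H x}
    (h : IsSlowForward A lam ξ) (hlam : 0 < lam) : IsSlowForward A lam (lpRe ξ) := by
  obtain ⟨s, hs, hs'⟩ := h
  refine ⟨fun j => ChainFlare.lpRe (s j), (continuous_lpRe.tendsto ξ).comp hs,
    squeeze_zero (fun j => by positivity) (fun j => ?_) hs'⟩
  rw [pow_lpRe hA]
  gcongr
  exact norm_lpRe_le _

theorem IsSlowBackward.lpRe (hA : ∀ y, A (star y) = star (A y)) {ξ : L2Chain H x}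
    (h : IsSlowBackward A lam ξ) (hlam : 0 < lam) : IsSlowBackward A lam (lpRe ξ) := by
  obtain ⟨s, hs, hs'⟩ := h
  refine ⟨fun j => ChainFlare.lpRe (s j), ?_,
    squeeze_zero (fun j => by positivity) (fun j => ?_) hs'⟩
  · simp only [pow_lpRe hA]
    exact (continuous_lpRe.tendsto ξ).comp hs
  · gcongr
    exact norm_lpRe_le _

/-- Translates of a fixed chain have bounded orbits. -/
theorem toL2_translate_mem_bounded (hA : IsL2Extension f hx A) (hf : f.IsHomotopyEquiv)
    {ρ : RelChain H x} (hρ : relMap H f hx ρ = ρ) (g : PathClass x x) :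
    toL2 (RelChain.translate g ρ) ∈ boundedForward A ⊓ boundedBackward A := by
  have hstep : ∀ (j : ℕ) (g : PathClass x x), (A ^ j) (toL2 (RelChain.translate g ρ)) =
      toL2 (RelChain.translate ((groupMap f hx)^[j] g) ρ) := by
    intro j
    induction j with
    | zero => intro g; rfl
    | succ j ih =>
      intro g
      rw [pow_succ, mul_apply_eq_comp, hA, relMap_translate, hρ, ih]; rfl
  refine ⟨⟨‖toL2 ρ‖, fun j => ?_⟩, ⟨‖toL2 ρ‖, fun j => ?_⟩⟩
  · rw [hstep, norm_toL2_translate]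
  -- Surjectivity of φʲ provides a translate of ρ, of the same norm, as preimage.
  · obtain ⟨h, hh⟩ := ((groupMap_bijective f hx hf).2.iterate j) g
    exact ⟨toL2 (RelChain.translate h ρ), by rw [hstep, hh], (norm_toL2_translate h ρ).le⟩

theorem l2Closure_subset_of_forall_mem {W : Submodule ℚ (RelChain H x)}
    {K : Submodule ℂ (L2Chain H x)} (h : ∀ c ∈ W, toL2 c ∈ K) :
    (l2Closure W : Set (L2Chain H x)) ⊆ closure (K : Set (L2Chain H x)) := by
  rw [l2Closure, Submodule.topologicalClosure_coe]
  refine closure_mono (Submodule.span_le.2 ?_)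
  rintro _ ⟨c, hc, rfl⟩
  exact h c hc

theorem toL2_mem_bounded {Vh Vqf : Submodule ℚ (RelChain H x)} (hA : IsL2Extension f hx A)
    (hf : f.IsHomotopyEquiv) (hH : H.IsInvariant f) (hcf : ChainFlareCondition f hx Vh Vqf)
    {c : RelChain H x} (hc : c ∈ Vqf) : toL2 c ∈ boundedForward A ⊓ boundedBackward A := by
  by_cases hbot : Vqf = ⊥
  · rw [hbot, Submodule.mem_bot] at hc
    rw [hc, toL2_zero]
    exact zero_mem _
  obtain ⟨ρ, hρ, hspan⟩ := hcf.quasi_fixed hbot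
  have hfix := relMap_eq_self_of_isFixedPathChain hH hρ.1
  replace hc := hspan c hc
  induction hc using Submodule.span_induction with
  | mem c hc =>
    obtain ⟨g, rfl⟩ := hc
    exact toL2_translate_mem_bounded hA hf hfix g
  | zero => rw [toL2_zero]; exact zero_mem _
  | add c d _ _ hc hd => rw [toL2_add]; exact add_mem hc hd
  | smul q c _ hc => rw [toL2_smul]; exact Submodule.smul_mem _ _ hc

theorem l2Closure_eq_inter [Finite (BaseEdge H)] (hconn : ∀ a : V, Nonempty (PathClass x a))
    {Vh Vqf : Submodule ℚ (RelChain H x)} (hA : IsL2Extension f hx A)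
    (hf : f.IsHomotopyEquiv) (hH : H.IsInvariant f) (hcf : ChainFlareCondition f hx Vh Vqf)
    (hlam : 1 < lam) (hθ : θ < 1)
    (hflare : ∀ c ∈ orbitSet (relMap H f hx) (angleNhd θ Vh),
      lam * chainNorm (relMap H f hx c) ≤
        max (chainNorm (relMap H f hx (relMap H f hx c))) (chainNorm c))
    {ν : ℝ} (hν : 1 ≤ ν) (hνlam : ν < lam) :
    (l2Closure Vqf : Set (L2Chain H x)) = subspaceE A ν ∩ subspaceF A ν⁻¹ := by
  have hsub : (l2Closure Vqf : Set (L2Chain H x)) ⊆ subspaceE A ν ∩ subspaceF A ν⁻¹ := fun ξ hξ =>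
    ⟨closure_boundedForward_subset hν (l2Closure_subset_of_forall_mem
      (fun c hc => (toL2_mem_bounded hA hf hH hcf hc).1) hξ),
     closure_boundedBackward_subset hν (l2Closure_subset_of_forall_mem
      (fun c hc => (toL2_mem_bounded hA hf hH hcf hc).2) hξ)⟩
  refine hsub.antisymm fun ξ hξ => ?_
  have hν0 : 0 < ν := by linarith
  have hl : 0 < lam := by linarith
  have hAre := map_star_of_forall_toL2 hA
  obtain ⟨P, L, hP, hLh, hLq⟩ := exists_clm_of_sup_eq_top hconn hcf.invariant_h hcf.invariant_qf
    hcf.sum_eq_top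
  have hPre := map_star_of_forall_toL2 hP
  -- For real ζ the vector Pζ is a limit of rational chains in `Vh`, without passing to their
  -- complex span.
  have hreal : ∀ ζ : L2Chain H x, IsSlowForward A lam ζ → IsSlowBackward A lam ζ →
      IsRealFamily ζ → ζ ∈ l2Closure Vqf := by
    intro ζ h1 h2 h3
    have hmem := mem_closure_range_toL2 h3
    have hPh : P ζ ∈ closure (toL2 '' (Vh : Set (RelChain H x))) := by
      refine map_mem_closure P.continuous hmem ?_
      rintro _ ⟨c, rfl⟩
      exact ⟨L c, hLh c, (hP c).symm⟩
    have hPq : ζ - P ζ ∈ l2Closure Vqf := by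
      refine map_mem_closure (f := fun y => y - P y) (by fun_prop) hmem ?_
      rintro _ ⟨c, rfl⟩
      exact Submodule.subset_span ⟨c - L c, hLq c, by simp only [toL2_sub, hP]⟩
    -- The inclusion already proved is fed back, so that slowness passes from ζ to Pζ.
    have hslow := hsub hPq
    have h4 := h1.sub hl (isSlowForward_of_mem_subspaceE hν0 hνlam hslow.1)
    have h5 := h2.sub hl (isSlowBackward_of_mem_subspaceF hν0 hνlam hslow.2)
    rw [sub_sub_cancel] at h4 h5
    have h6 : IsRealFamily (P ζ) := by
      have h3' : star ζ = ζ := h3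
      rw [IsRealFamily, ← hPre, h3']
    have h0 := eq_zero_of_isSlow hA hlam hθ hflare h6 hPh h4 h5
    rwa [h0, sub_zero] at hPq
  have hF := isSlowForward_of_mem_subspaceE hν0 hνlam hξ.1
  have hB := isSlowBackward_of_mem_subspaceF hν0 hνlam hξ.2
  have h1 := hreal _ (hF.lpRe hAre hl) (hB.lpRe hAre hl) (isRealFamily_lpRe ξ)
  have h2 := hreal _ ((hF.smul (-Complex.I)).lpRe hAre hl) ((hB.smul (-Complex.I)).lpRe hAre hl)
    (isRealFamily_lpRe _)
  rw [← lpRe_add_I_smul ξ]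
  exact add_mem h1 (Submodule.smul_mem _ _ h2)

end Main

end ChainFlare

end

theorem mainTheorem4 {V : Type u} [Quiver.{v} V] [Finite V] [∀ a b : V, Finite (a ⟶ b)]
    (x : V) (hconn : ∀ a : V, Nonempty (ChainFlare.PathClass x a))
    (f : ChainFlare.GraphMap V) (hf : f.IsHomotopyEquiv) (hx : f.obj x = x)
    (H : ChainFlare.Subgraph V) (hH : H.IsInvariant f)
    (Vh Vqf : Submodule ℚ (ChainFlare.RelChain H x))
    (hcf : ChainFlare.ChainFlareCondition f hx Vh Vqf) :
    (∃! A : ChainFlare.L2Chain H x →L[ℂ] ChainFlare.L2Chain H x,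
      ChainFlare.IsL2Extension f hx A) ∧
    ∃ lam : ℝ, 1 < lam ∧
      ∀ A : ChainFlare.L2Chain H x →L[ℂ] ChainFlare.L2Chain H x,
        ChainFlare.IsL2Extension f hx A →
        ∀ ν : ℝ, 1 ≤ ν → ν < lam →
          (ChainFlare.l2Closure Vqf : Set (ChainFlare.L2Chain H x)) =
            ChainFlare.subspaceE A ν ∩ ChainFlare.subspaceF A ν⁻¹ := by
  have hfin : Finite (ChainFlare.BaseEdge H) := by infer_instance
  refine ⟨ChainFlare.existsUnique_isL2Extension hconn hf hx, ?_⟩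
  obtain ⟨lam, θ, hlam, -, hθ, hflare⟩ := hcf.flare
  exact ⟨lam, hlam, fun A hA ν hν hνlam =>
    ChainFlare.l2Closure_eq_inter hconn hA hf hH hcf hlam hθ hflare hν hνlam⟩
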